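/- **Notation.** Let $N$ run through a strictly increasing sequence of natural numbers (for instance all of them), and for each such $N$ let $M=M(N)\in\mathbb N$; all matrices below depend on $N$. For real quantities write $a_N\lesssim b_N$ if there are constants $C>0$ and $N_0>0$ with $a_N\le C\,b_N$ for all $N\ge N_0$ in the sequence. $\|\cdot\|_2$ is the spectral norm and $\|B\|_{\max}=\max_{i,j}|B_{ij}|$. A sequence of matrices $B\in\mathbb C^{M\times N}$ is *spectrally convergent* if there is a compactly supported probability distribution $\mu$ on $[0,\infty)$ with $\frac1N\mathrm{tr}[(B^{\mathsf H}B)^k]\to\int\lambda^k\,\mu(d\lambda)$ as $N\to\infty$ for every fixed integer $k\ge1$. A *uniformly random phase matrix* is $D=\mathrm{diag}(e^{\mathrm i\theta_1},\dots,e^{\mathrm i\theta_N})$ with $\theta_1,\dots,\theta_N$ i.i.d. uniform on $[0,2\pi)$. **Universality class.** A sequence of random matrices $W\in\mathbb C^{M\times N}$ (for all $N$ on one probability space) lies in the (complex) universality class $\mathscr U$ if $W=JD$ where, for each $N$, $D$ is a uniformly random phase matrix and $J\in\mathbb C^{M\times N}$ is a random (possibly deterministic) matrix independent of $D$, and where almost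 surely: $J$ is spectrally convergent, $\|J\|_2\lesssim1$, and for every fixed integer $k\ge1$ and every $\epsilon>0$ $$\Big\|(J^{\mathsf H}J)^k-\frac{\mathrm{tr}[(J^{\mathsf H}J)^k]}{N}I_N\Big\|_{\max}\lesssim N^{-1/2+\epsilon}.$$ **Theorem 1 (Permutation-invariant matrices).** Let $A\in\mathbb C^{M\times N}$ be (a sequence of) deterministic matrices that is spectrally convergent, satisfies $\|A\|_2\lesssim1$, and satisfies, for every fixed integer $k\ge1$ and every $\epsilon>0$, the off-diagonal-sum condition $$\Big|\sum_{i,j\in[N],\,i\ne j}\big[(A^{\mathsf H}A)^k\big]_{ij}\Big|\lesssim N^{1/2+\epsilon}.$$ Let $U\in\mathbb C^{N\times N}$ be deterministic unitary matrices with $\|U\|_{\max}\lesssim N^{-1/2+\epsilon}$ for every $\epsilon>0$. On one probability space let, for each $N$, $D$ be an $N\times N$ uniformly random phase matrix and $\Pi$ a uniformly random $N\times N$ permutation matrix independent of $D$ (the joint law over different $N$ is arbitrary). Then $A\,\Pi\,U\,D\in\mathscr U$. -/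

import Mathlib

open MeasureTheory ProbabilityTheory Filter Topology
open scoped Matrix

namespace RandomMux

/-- The spectral norm `‖A‖₂`, i.e. the operator norm for the Euclidean norms. -/
noncomputable def specNorm {m n : ℕ} (A : Matrix (Fin m) (Fin n) ℂ) : ℝ :=
  ‖LinearMap.toContinuousLinearMap (Matrix.toEuclideanLin A)‖

/-- The max norm `‖A‖_max = max_{i,j} |A i j|` (zero for a matrix without entries). -/
noncomputable def maxNorm {m n : ℕ} (A : Matrix (Fin m) (Fin n) ℂ) : ℝ :=
  ⨆ p : Fin m × Fin n, ‖A p.1 p.2‖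

/-- `a ≲ b` along the dimensions `N 0 < N 1 < ⋯`: there are constants `C, N₀ > 0` with
`a ≤ C b` for all dimensions `≥ N₀`. -/
def LessSim (N : ℕ → ℕ) (a b : ℕ → ℝ) : Prop :=
  ∃ C : ℝ, 0 < C ∧ ∃ N₀ : ℕ, 0 < N₀ ∧ ∀ n, N₀ ≤ N n → a n ≤ C * b n

/-- Spectral convergence: `tr[(Aᴴ A)^k] / N → ∫ λ^k dν` for every `k ≥ 1`, with `ν` a compactly
supported probability distribution on `[0, ∞)`. -/
def SpectrallyConvergent {M N : ℕ → ℕ} (A : ∀ n, Matrix (Fin (M n)) (Fin (N n)) ℂ) : Prop :=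
  ∃ ν : Measure ℝ, IsProbabilityMeasure ν ∧ (∃ R : ℝ, ν (Set.Icc 0 R)ᶜ = 0) ∧
    ∀ k : ℕ, 1 ≤ k →
      Tendsto (fun n => (((A n)ᴴ * A n) ^ k).trace / (N n : ℂ)) atTop
        (𝓝 ((∫ x : ℝ, x ^ k ∂ν : ℝ) : ℂ))

/-- Bounded spectral norm: `‖A‖₂ ≲ 1`. -/
def NormBounded {M N : ℕ → ℕ} (A : ∀ n, Matrix (Fin (M n)) (Fin (N n)) ℂ) : Prop :=
  LessSim N (fun n => specNorm (A n)) (fun _ => 1)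

/-- The off-diagonal-sum condition. -/
def OffDiagonalSumCondition {M N : ℕ → ℕ}
    (A : ∀ n, Matrix (Fin (M n)) (Fin (N n)) ℂ) : Prop :=
  ∀ k : ℕ, 1 ≤ k → ∀ ε : ℝ, 0 < ε →
    LessSim N
      (fun n => ‖∑ i : Fin (N n), ∑ j : Fin (N n),
        if i ≠ j then (((A n)ᴴ * A n) ^ k) i j else 0‖)
      (fun n => (N n : ℝ) ^ (1 / 2 + ε : ℝ))

/-- `‖U‖_max ≲ N^{-1/2+ε}` for every `ε > 0`. -/
def Delocalized {N : ℕ → ℕ} (U : ∀ n, Matrix (Fin (N n)) (Fin (N n)) ℂ) : Prop :=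
  ∀ ε : ℝ, 0 < ε →
    LessSim N (fun n => maxNorm (U n)) (fun n => (N n : ℝ) ^ (-1 / 2 + ε : ℝ))

/-- The max-norm condition of the universality class:
`‖(Jᴴ J)^k - (tr[(Jᴴ J)^k] / N) I‖_max ≲ N^{-1/2+ε}` for all `k ≥ 1` and `ε > 0`. -/
def MomentConcentration {M N : ℕ → ℕ} (J : ∀ n, Matrix (Fin (M n)) (Fin (N n)) ℂ) : Prop :=
  ∀ k : ℕ, 1 ≤ k → ∀ ε : ℝ, 0 < ε →
    LessSim N
      (fun n => maxNorm (((J n)ᴴ * J n) ^ k -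
        ((((J n)ᴴ * J n) ^ k).trace / (N n : ℂ)) • (1 : Matrix (Fin (N n)) (Fin (N n)) ℂ)))
      (fun n => (N n : ℝ) ^ (-1 / 2 + ε : ℝ))

section Random

variable {Ω : Type*} [MeasurableSpace Ω]

/-- `D = diag(e^{iθ_1}, …, e^{iθ_d})` with `θ_1, …, θ_d` i.i.d. uniform on `[0, 2π)`. -/
def IsUniformPhaseMatrix (P : Measure Ω) {d : ℕ} (D : Ω → Matrix (Fin d) (Fin d) ℂ) : Prop :=
  ∃ θ : Fin d → Ω → ℝ,
    (∀ i, Measurable (θ i)) ∧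
    (∀ i, pdf.IsUniform (θ i) (Set.Ico 0 (2 * Real.pi)) P volume) ∧
    iIndepFun θ P ∧
    ∀ ω, D ω = Matrix.diagonal fun i => Complex.exp (Complex.I * (θ i ω : ℂ))

/-- `Q` is a uniformly random `d × d` permutation matrix, `Q i j = 1` iff `π i = j`. -/
def IsUniformPermMatrix (P : Measure Ω) {d : ℕ} (Q : Ω → Matrix (Fin d) (Fin d) ℂ) : Prop :=
  ∃ π : Ω → Equiv.Perm (Fin d),
    (∀ σ, MeasurableSet {ω | π ω = σ}) ∧
    (∀ σ, P {ω | π ω = σ} = ((d.factorial : ℕ) : ENNReal)⁻¹) ∧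
    ∀ ω, Q ω = (π ω).permMatrix ℂ

/-- The matrix spaces carry the product (Borel) σ-algebra of their entries. -/
noncomputable instance matrixMeasurableSpace {m n : ℕ} : MeasurableSpace (Matrix (Fin m) (Fin n) ℂ) :=
  inferInstanceAs (MeasurableSpace (Fin m → Fin n → ℂ))

/-- Membership of a (sequence of) random matrices `W` in the complex universality class:
`W = J D` with `D` a uniformly random phase matrix, `J` independent of `D`, and `J` almost surely
spectrally convergent, of bounded spectral norm and with concentrated moments. A deterministic
`J` is the special case of a constant one. -/
def MemUniversalityClass (P : Measure Ω) {M N : ℕ → ℕ}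
    (W : ∀ n, Ω → Matrix (Fin (M n)) (Fin (N n)) ℂ) : Prop :=
  ∃ (J : ∀ n, Ω → Matrix (Fin (M n)) (Fin (N n)) ℂ)
    (D : ∀ n, Ω → Matrix (Fin (N n)) (Fin (N n)) ℂ),
    (∀ n ω, W n ω = J n ω * D n ω) ∧
    (∀ n, IsUniformPhaseMatrix P (D n)) ∧
    (∀ n, Measurable (J n)) ∧
    (∀ n, IndepFun (J n) (D n) P) ∧
    ∀ᵐ ω ∂P, SpectrallyConvergent (fun n => J n ω) ∧ NormBounded (fun n => J n ω) ∧
      MomentConcentration (fun n => J n ω)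

end Random

end RandomMux

/-! Take `J = A Π U` and `B = (Aᴴ A)^k`. Since `Π U` is unitary, `(Jᴴ J)^k = (Π U)ᴴ B (Π U)`, so
traces are unchanged and spectral norms do not grow. Only the entrywise concentration is
probabilistic: entry `(a, b)` is the form of `B` at columns `a` and `b` of `U`, permuted by the same
random permutation (`conj_permMatrix_mul_apply`).

Mean: by double transitivity only `tr B` and the off-diagonal sum of `B` enter. Orthonormality of
the columns turns the trace part into `(tr B / N) δ_ab`, and the rest is at most `3 ‖offDiagSum B‖ /
N`, which is of order `N^{-1/2+ε}` (`exists_mean_permForm`).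

Fluctuation: revealing the permutation value by value gives a Poincaré inequality with weighted
transpositions (`poincare_perm`). Applied to powers of a function, it bounds moments of order
`2^(j+1)` by powers of a uniform bound on the local variation (`sum_pow_le_of_localVariation_le`).
For these forms that bound is of order `‖B‖² (μ² log N + N μ⁴)` with `μ = ‖U‖_max`, hence nearly
`1/N` (`localVariation_permForm_le`).

Markov's inequality with a high moment survives a union bound over the `N²` entries and leaves
failure probability `O(N⁻²)`; Borel–Cantelli concludes, whatever the joint law over different `N`.
-/

namespace RandomMux

/-! ### Poincaré inequality on the symmetric group -/

section Poincare

/-- The weight of the transposition `(k l)` in the Poincaré inequality obtained by revealing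
a permutation one value at a time. -/
noncomputable def swapWeight {d : ℕ} (k l : Fin d) : ℝ :=
  if k < l then 1 / (2 * ((d : ℝ) - (k : ℕ))) else 0

lemma swapWeight_nonneg {d : ℕ} (k l : Fin d) : 0 ≤ swapWeight k l := by
  unfold swapWeight
  split_ifs
  · have : ((k : ℕ) : ℝ) ≤ d := by exact_mod_cast k.2.le
    have : 0 ≤ (d : ℝ) - (k : ℕ) := by linarith
    positivity
  · exact le_rfl

lemma swapWeight_succ_succ {n : ℕ} (k l : Fin n) :
    swapWeight k.succ l.succ = swapWeight k l := by
  simp [swapWeight, Fin.succ_lt_succ_iff]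

lemma swapWeight_zero_succ {n : ℕ} (l : Fin n) :
    swapWeight (0 : Fin (n + 1)) l.succ = 1 / (2 * ((n : ℝ) + 1)) := by
  simp [swapWeight]

lemma swapWeight_zero_right {n : ℕ} (k : Fin (n + 1)) : swapWeight k 0 = 0 := by
  simp [swapWeight]

/-- The weighted sum of squared increments of `f` under transpositions. -/
noncomputable def localVariation {d : ℕ} {E : Type*} [NormedAddCommGroup E]
    (f : Equiv.Perm (Fin d) → E) (σ : Equiv.Perm (Fin d)) : ℝ :=
  ∑ k, ∑ l, swapWeight k l * ‖f σ - f (σ * Equiv.swap k l)‖ ^ 2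

lemma sum_perm_succ {n : ℕ} {E : Type*} [AddCommMonoid E] (f : Equiv.Perm (Fin (n + 1)) → E) :
    ∑ σ, f σ = ∑ p, ∑ e, f (Equiv.Perm.decomposeFin.symm (p, e)) := by
  rw [← Equiv.sum_comp Equiv.Perm.decomposeFin.symm, Fintype.sum_prod_type]

lemma sum_fiber_eq {n : ℕ} (f : Equiv.Perm (Fin (n + 1)) → ℝ) (p : Fin (n + 1)) :
    ∑ e, f (Equiv.Perm.decomposeFin.symm (p, e)) = ∑ σ, if σ 0 = p then f σ else 0 := by
  rw [sum_perm_succ]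
  simp

/-- Right multiplication by a transposition avoiding `0` preserves the fiber `σ 0 = p`. Hence the
increments in the induction hypothesis on a fiber are increments of the full group. -/
lemma decomposeFin_symm_mul_swap {n : ℕ} (p : Fin (n + 1)) (e : Equiv.Perm (Fin n))
    (k l : Fin n) :
    Equiv.Perm.decomposeFin.symm (p, e * Equiv.swap k l) =
      Equiv.Perm.decomposeFin.symm (p, e) * Equiv.swap k.succ l.succ := by
  ext x
  refine Fin.cases ?_ (fun i => ?_) x
  · rw [Equiv.Perm.mul_apply, Equiv.swap_apply_of_ne_of_ne (Fin.succ_ne_zero _).symm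
      (Fin.succ_ne_zero _).symm]
    simp
  · rw [Equiv.Perm.mul_apply, ← Function.Injective.map_swap (Fin.succ_injective n)]
    simp

/-- Comparison of the sums of `f` over two fibers of `σ ↦ σ 0`. -/
lemma sq_sub_fiber_sum_le {n : ℕ} (f : Equiv.Perm (Fin (n + 1)) → ℝ) (p q : Fin (n + 1)) :
    (∑ e, f (Equiv.Perm.decomposeFin.symm (p, e)) -
      ∑ e, f (Equiv.Perm.decomposeFin.symm (q, e))) ^ 2 ≤
      (n.factorial : ℝ) *
        ∑ e, (f (Equiv.Perm.decomposeFin.symm (p, e)) -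
          f (Equiv.swap p q * Equiv.Perm.decomposeFin.symm (p, e))) ^ 2 := by
  -- Left multiplication by `swap p q` carries the fiber over `p` onto the fiber over `q`.
  have h : ∑ e, f (Equiv.Perm.decomposeFin.symm (q, e)) =
      ∑ e, f (Equiv.swap p q * Equiv.Perm.decomposeFin.symm (p, e)) := by
    rw [sum_fiber_eq, sum_fiber_eq (fun σ => f (Equiv.swap p q * σ)),
      ← Equiv.sum_comp (Equiv.mulLeft (Equiv.swap p q))]
    refine Finset.sum_congr rfl fun σ _ => ?_
    have : (Equiv.swap p q (σ 0) = q) ↔ σ 0 = p := by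
      rw [Equiv.swap_apply_eq_iff, Equiv.swap_apply_right]
    simp [this]
  rw [h, ← Finset.sum_sub_distrib]
  have := sq_sum_le_card_mul_sum_sq (s := (Finset.univ : Finset (Equiv.Perm (Fin n))))
    (f := fun e => f (Equiv.Perm.decomposeFin.symm (p, e)) -
          f (Equiv.swap p q * Equiv.Perm.decomposeFin.symm (p, e)))
  simpa [Fintype.card_perm] using this

/-- On the fiber `σ 0 = p`, writing `q = σ l` turns the left factor `swap p q` into the right factor
`swap 0 l`, the kind of increment that `localVariation` measures. -/
lemma sum_sq_sub_fiber_sum_le {n : ℕ} (f : Equiv.Perm (Fin (n + 1)) → ℝ) :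
    ∑ p, ∑ q, (∑ e, f (Equiv.Perm.decomposeFin.symm (p, e)) -
      ∑ e, f (Equiv.Perm.decomposeFin.symm (q, e))) ^ 2 ≤
      (n.factorial : ℝ) *
        ∑ σ, ∑ l : Fin (n + 1), (f σ - f (σ * Equiv.swap 0 l)) ^ 2 := by
  rw [sum_perm_succ, Finset.mul_sum]
  refine Finset.sum_le_sum fun p _ => ?_
  refine (Finset.sum_le_sum fun q _ => sq_sub_fiber_sum_le f p q).trans_eq ?_
  rw [← Finset.mul_sum, Finset.sum_comm]
  congr 1
  refine Finset.sum_congr rfl fun e _ => ?_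
  set σ := Equiv.Perm.decomposeFin.symm (p, e) with hσ
  rw [← Equiv.sum_comp σ]
  refine Finset.sum_congr rfl fun l _ => ?_
  have : Equiv.swap p (σ l) * σ = σ * Equiv.swap 0 l := by
    have h0 : σ 0 = p := by simp [hσ]
    rw [Equiv.mul_swap_eq_swap_mul, h0]
  rw [this]

/-- **Poincaré inequality on the symmetric group**. -/
theorem poincare_perm {d : ℕ} (f : Equiv.Perm (Fin d) → ℝ) :
    (d.factorial : ℝ) * ∑ σ, f σ ^ 2 - (∑ σ, f σ) ^ 2 ≤
      (d.factorial : ℝ) * ∑ σ, localVariation f σ := by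
  induction d with
  | zero => simp [localVariation]
  | succ n ih =>
    set F : Fin (n + 1) → ℝ := fun p => ∑ e, f (Equiv.Perm.decomposeFin.symm (p, e)) with hF
    -- The between-fiber part of the variance, as a sum over pairs of fibers.
    have hvar : ((n : ℝ) + 1) * ∑ p, F p ^ 2 - (∑ p, F p) ^ 2 =
        1 / 2 * ∑ p, ∑ q, (F p - F q) ^ 2 := by
      simp only [sub_sq, Finset.sum_add_distrib, Finset.sum_sub_distrib, mul_assoc,
        ← Finset.mul_sum, ← Finset.sum_mul, Finset.sum_const, Finset.card_univ, Fintype.card_fin,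
        nsmul_eq_mul, Nat.cast_add, Nat.cast_one]
      ring
    -- The rows `k ≥ 1` of the weights reproduce the weights one size down; the row `k = 0`, with
    -- weight `1 / (2 (n + 1))`, pays for the between-fiber variance.
    have hsplit : ∑ σ, localVariation f σ =
        ∑ p, ∑ e, localVariation (fun e => f (Equiv.Perm.decomposeFin.symm (p, e))) e +
        1 / (2 * ((n : ℝ) + 1)) * ∑ σ, ∑ l : Fin (n + 1), (f σ - f (σ * Equiv.swap 0 l)) ^ 2 := by
      have h1 : ∀ σ, localVariation f σ =
          (∑ k : Fin n, ∑ l : Fin n, swapWeight k l *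
            ‖f σ - f (σ * Equiv.swap k.succ l.succ)‖ ^ 2) +
          1 / (2 * ((n : ℝ) + 1)) * ∑ l : Fin (n + 1), (f σ - f (σ * Equiv.swap 0 l)) ^ 2 := by
        intro σ
        unfold localVariation
        simp only [Fin.sum_univ_succ, swapWeight_zero_right, swapWeight_succ_succ,
          swapWeight_zero_succ, zero_mul, zero_add, Real.norm_eq_abs, sq_abs]
        rw [add_comm, Equiv.swap_self]
        simp [← Equiv.Perm.one_def, Finset.mul_sum]
      simp only [h1, Finset.sum_add_distrib, ← Finset.mul_sum]
      congr 1
      rw [sum_perm_succ]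
      simp only [localVariation, decomposeFin_symm_mul_swap]
    have hIH := Finset.sum_le_sum fun p (_ : p ∈ Finset.univ) =>
      ih (fun e => f (Equiv.Perm.decomposeFin.symm (p, e)))
    have hG := sum_sq_sub_fiber_sum_le f
    rw [Finset.sum_sub_distrib, ← Finset.mul_sum, ← Finset.mul_sum] at hIH
    rw [hsplit, sum_perm_succ (fun σ => f σ ^ 2), sum_perm_succ f, Nat.factorial_succ]
    push_cast
    change _ - ∑ p, F p ^ 2 ≤ _ at hIH
    change ∑ p, ∑ q, (F p - F q) ^ 2 ≤ _ at hG
    change _ - (∑ p, F p) ^ 2 ≤ _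
    have hn : (0 : ℝ) < (n : ℝ) + 1 := by positivity
    have e1 : ((n : ℝ) + 1) * n.factorial * (1 / (2 * ((n : ℝ) + 1)) *
        ∑ σ, ∑ l : Fin (n + 1), (f σ - f (σ * Equiv.swap 0 l)) ^ 2) =
        1 / 2 * (n.factorial * ∑ σ, ∑ l : Fin (n + 1), (f σ - f (σ * Equiv.swap 0 l)) ^ 2) := by
      field_simp
    rw [mul_add, e1]
    have := mul_le_mul_of_nonneg_left hIH hn.le
    linarith

end Poincare

/-! ### From variance to high moments -/

section Moments

/-- Factor out `a - b`; each of the `q + 1` remaining terms is at most `max |a| |b| ^ q`, and the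
maximum is then replaced by a sum, which is symmetric in `a` and `b`. -/
lemma sq_sub_pow_le (a b : ℝ) (q : ℕ) :
    (a ^ (q + 1) - b ^ (q + 1)) ^ 2 ≤
      ((q : ℝ) + 1) ^ 2 * ((a - b) ^ 2 * ((a ^ 2) ^ q + (b ^ 2) ^ q)) := by
  have key : ∀ m : ℝ, 0 ≤ m → |a| ≤ m → |b| ≤ m →
      (a ^ (q + 1) - b ^ (q + 1)) ^ 2 ≤ ((q : ℝ) + 1) ^ 2 * ((a - b) ^ 2 * (m ^ 2) ^ q) := by
    intro m hm ha hb
    rw [← (Commute.all a b).geom_sum₂_mul, mul_pow]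
    have h : |∑ i ∈ Finset.range (q + 1), a ^ i * b ^ (q + 1 - 1 - i)| ≤ ((q : ℝ) + 1) * m ^ q := by
      refine (Finset.abs_sum_le_sum_abs _ _).trans ?_
      refine (Finset.sum_le_card_nsmul _ _ (m ^ q) fun i hi => ?_).trans_eq (by simp)
      rw [abs_mul, abs_pow, abs_pow]
      have : i + (q + 1 - 1 - i) = q := by have := Finset.mem_range.1 hi; omega
      calc |a| ^ i * |b| ^ (q + 1 - 1 - i) ≤ m ^ i * m ^ (q + 1 - 1 - i) := by gcongr
        _ = m ^ q := by rw [← pow_add, this]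
    have h2 := pow_le_pow_left₀ (abs_nonneg _) h 2
    rw [sq_abs] at h2
    calc _ ≤ (((q : ℝ) + 1) * m ^ q) ^ 2 * (a - b) ^ 2 := by gcongr
      _ = _ := by ring
  rcases le_total |a| |b| with h | h
  · refine (key |b| (abs_nonneg _) h le_rfl).trans ?_
    rw [sq_abs]
    gcongr
    have : 0 ≤ (a ^ 2) ^ q := by positivity
    linarith
  · refine (key |a| (abs_nonneg _) le_rfl h).trans ?_
    rw [sq_abs]
    gcongr
    have : 0 ≤ (b ^ 2) ^ q := by positivity
    linarith

lemma sum_localVariation_pow_le {d : ℕ} (f : Equiv.Perm (Fin d) → ℝ) {v : ℝ}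
    (hv : ∀ σ, localVariation f σ ≤ v) (q : ℕ) :
    ∑ σ, localVariation (fun σ => f σ ^ (q + 1)) σ ≤
      2 * ((q : ℝ) + 1) ^ 2 * v * ∑ σ, (f σ ^ 2) ^ q := by
  -- The involution `σ ↦ σ * swap k l` exchanges the two endpoints of an increment, so both endpoint
  -- terms contribute equally.
  have hsym : ∀ k l : Fin d,
      ∑ σ, (f σ - f (σ * Equiv.swap k l)) ^ 2 * (f (σ * Equiv.swap k l) ^ 2) ^ q =
      ∑ σ, (f σ - f (σ * Equiv.swap k l)) ^ 2 * (f σ ^ 2) ^ q := by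
    intro k l
    rw [← Equiv.sum_comp (Equiv.mulRight (Equiv.swap k l))]
    refine Finset.sum_congr rfl fun σ _ => ?_
    simp only [Equiv.coe_mulRight, mul_assoc, Equiv.swap_mul_self, mul_one]
    ring
  calc ∑ σ, localVariation (fun σ => f σ ^ (q + 1)) σ
      ≤ ∑ σ, ∑ k, ∑ l, swapWeight k l * (((q : ℝ) + 1) ^ 2 *
        ((f σ - f (σ * Equiv.swap k l)) ^ 2 *
          ((f σ ^ 2) ^ q + (f (σ * Equiv.swap k l) ^ 2) ^ q))) := by
        unfold localVariation
        gcongr with σ _ k _ l _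
        · exact swapWeight_nonneg _ _
        · rw [Real.norm_eq_abs, sq_abs]
          exact sq_sub_pow_le _ _ _
    _ = ∑ k, ∑ l, swapWeight k l * (((q : ℝ) + 1) ^ 2 *
        (2 * ∑ σ, (f σ - f (σ * Equiv.swap k l)) ^ 2 * (f σ ^ 2) ^ q)) := by
        rw [Finset.sum_comm]
        refine Finset.sum_congr rfl fun k _ => ?_
        rw [Finset.sum_comm]
        refine Finset.sum_congr rfl fun l _ => ?_
        rw [← Finset.mul_sum, ← Finset.mul_sum]
        simp only [mul_add, Finset.sum_add_distrib, hsym]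
        ring
    _ = 2 * ((q : ℝ) + 1) ^ 2 * ∑ σ, localVariation f σ * (f σ ^ 2) ^ q := by
        unfold localVariation
        simp only [Finset.sum_mul, Finset.mul_sum]
        rw [Finset.sum_comm (s := (Finset.univ : Finset (Equiv.Perm (Fin d))))]
        refine Finset.sum_congr rfl fun k _ => ?_
        rw [Finset.sum_comm (s := (Finset.univ : Finset (Equiv.Perm (Fin d))))]
        refine Finset.sum_congr rfl fun l _ => ?_
        refine Finset.sum_congr rfl fun σ _ => ?_
        rw [Real.norm_eq_abs, sq_abs]
        ring
    _ ≤ 2 * ((q : ℝ) + 1) ^ 2 * ∑ σ, v * (f σ ^ 2) ^ q := by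
        gcongr with σ _
        exact hv σ
    _ = _ := by rw [← Finset.mul_sum]; ring

/-- A Young-type splitting according to whether `2 * c ≤ x`. The factor `1 / 2` lets the top moment
be absorbed into the left side of the Poincaré inequality. -/
lemma mul_pow_le_half_pow_succ_add {c x : ℝ} (hc : 0 ≤ c) (hx : 0 ≤ x) (q : ℕ) :
    c * x ^ q ≤ 1 / 2 * x ^ (q + 1) + (2 * c) ^ (q + 1) := by
  rcases le_total (2 * c) x with h | h
  · have : c * x ^ q ≤ 1 / 2 * x ^ (q + 1) := by
      rw [pow_succ]; nlinarith [pow_nonneg hx q]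
    have : 0 ≤ (2 * c) ^ (q + 1) := by positivity
    linarith
  · have h1 : c * x ^ q ≤ c * (2 * c) ^ q := by gcongr
    have : 0 ≤ x ^ (q + 1) := by positivity
    have : 0 ≤ c * (2 * c) ^ q := by positivity
    rw [pow_succ (2 * c)]
    nlinarith

/-- High moments of a centered function on the symmetric group are controlled by a uniform bound
on its local variation. -/
theorem sum_pow_le_of_localVariation_le (j : ℕ) :
    ∃ C : ℝ, 0 < C ∧ ∀ (d : ℕ) (f : Equiv.Perm (Fin d) → ℝ) (v : ℝ), 0 ≤ v →
      (∀ σ, localVariation f σ ≤ v) → ∑ σ, f σ = 0 →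
      ∑ σ, (f σ ^ 2) ^ (2 ^ j) ≤ (d.factorial : ℝ) * (C * v ^ (2 ^ j)) := by
  induction j with
  | zero =>
    refine ⟨1, one_pos, fun d f v _ hv h0 => ?_⟩
    have hd : (0 : ℝ) < d.factorial := by positivity
    have h := poincare_perm f
    rw [h0] at h
    have h1 : ∑ σ, f σ ^ 2 ≤ ∑ σ, localVariation f σ := by
      apply le_of_mul_le_mul_left _ hd
      linarith
    have h2 : ∑ σ, localVariation f σ ≤ ∑ _σ : Equiv.Perm (Fin d), v :=
      Finset.sum_le_sum fun σ _ => hv σ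
    simp only [Finset.sum_const, Finset.card_univ, Fintype.card_perm, Fintype.card_fin,
      nsmul_eq_mul] at h2
    simpa using h1.trans h2
  | succ j ih =>
    obtain ⟨C, hC, H⟩ := ih
    -- Poincaré is applied to `f ^ (q + 1) = (f ^ 2) ^ (2 ^ j)`, whose mean is the moment controlled
    -- by the induction hypothesis.
    obtain ⟨q, hq⟩ : ∃ q, 2 ^ (j + 1) = q + 1 := ⟨2 ^ (j + 1) - 1, by
      have := Nat.one_le_two_pow (n := j + 1); omega⟩
    set K : ℝ := 2 * (2 * ((q : ℝ) + 1) ^ 2) with hK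
    refine ⟨2 * (C ^ 2 + K ^ (q + 1)), by positivity, fun d f v hv0 hv h0 => ?_⟩
    have hd : (0 : ℝ) < d.factorial := by positivity
    have hm := H d f v hv0 hv h0
    have hP := poincare_perm (fun σ => f σ ^ (q + 1))
    have hL := sum_localVariation_pow_le f hv q
    have e1 : ∀ σ, f σ ^ (q + 1) = (f σ ^ 2) ^ (2 ^ j) := by
      intro σ; rw [← hq, ← pow_mul, pow_succ']
    have e2 : ∀ σ, (f σ ^ (q + 1)) ^ 2 = (f σ ^ 2) ^ (2 ^ (j + 1)) := by
      intro σ; rw [← hq, ← pow_mul, ← pow_mul, mul_comm]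
    have e3 : v ^ (2 ^ (j + 1)) = (v ^ 2 ^ j) ^ 2 := by rw [← pow_mul, pow_succ]
    simp only [e2] at hP
    have hS : (∑ σ, f σ ^ (q + 1)) ^ 2 ≤ (d.factorial * (C * v ^ (2 ^ j))) ^ 2 := by
      simp only [e1]
      have : 0 ≤ ∑ σ, (f σ ^ 2) ^ (2 ^ j) := Finset.sum_nonneg fun σ _ => by positivity
      gcongr
    have hY : 2 * ((q : ℝ) + 1) ^ 2 * v * ∑ σ, (f σ ^ 2) ^ q ≤
        1 / 2 * ∑ σ, (f σ ^ 2) ^ (2 ^ (j + 1)) + d.factorial * (K * v) ^ (q + 1) := by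
      rw [Finset.mul_sum, Finset.mul_sum]
      have : (d.factorial : ℝ) * (K * v) ^ (q + 1) =
          ∑ _σ : Equiv.Perm (Fin d), (K * v) ^ (q + 1) := by
        simp [Fintype.card_perm]
      rw [this, ← Finset.sum_add_distrib]
      refine Finset.sum_le_sum fun σ _ => ?_
      have := mul_pow_le_half_pow_succ_add (c := 2 * ((q : ℝ) + 1) ^ 2 * v)
        (by positivity) (sq_nonneg (f σ)) q
      rwa [hq, show K * v = 2 * (2 * ((q : ℝ) + 1) ^ 2 * v) by rw [hK]; ring]
    have hY' := mul_le_mul_of_nonneg_left (hL.trans hY) hd.le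
    apply le_of_mul_le_mul_left _ hd
    rw [show (K * v) ^ (q + 1) = K ^ (q + 1) * (v ^ 2 ^ j) ^ 2 by rw [mul_pow, ← e3, hq]] at hY'
    rw [e3]
    nlinarith

end Moments

/-! ### Tail bounds for complex-valued functions -/

section Tail

lemma localVariation_le_of_norm_le {d : ℕ} {E F : Type*} [NormedAddCommGroup E]
    [NormedAddCommGroup F] {f : Equiv.Perm (Fin d) → E} {g : Equiv.Perm (Fin d) → F}
    (h : ∀ σ τ, ‖f σ - f τ‖ ≤ ‖g σ - g τ‖) (σ : Equiv.Perm (Fin d)) :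
    localVariation f σ ≤ localVariation g σ := by
  unfold localVariation
  gcongr with k _ l _
  · exact swapWeight_nonneg _ _
  · exact h _ _

/-- Polynomial tail bounds of every order for complex functions on the symmetric group. -/
theorem card_norm_sub_ge_le (j : ℕ) :
    ∃ C : ℝ, 0 < C ∧ ∀ (d : ℕ) (f : Equiv.Perm (Fin d) → ℂ) (v t : ℝ) (c : ℂ), 0 ≤ v → 0 < t →
      (∀ σ, localVariation f σ ≤ v) → ∑ σ, f σ = d.factorial * c →
      ((Finset.univ.filter fun σ => t ≤ ‖f σ - c‖).card : ℝ) ≤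
        (d.factorial : ℝ) * (C * (v / t ^ 2) ^ (2 ^ j)) := by
  obtain ⟨C, hC, H⟩ := sum_pow_le_of_localVariation_le j
  -- One `C` each for the real and imaginary parts; the power of two comes from convexity in `(re² +
  -- im²) ^ (2 ^ j)`.
  refine ⟨2 ^ (2 ^ j) * (C + C), by positivity, fun d f v t c hv0 ht hv hc => ?_⟩
  have h0 : ∑ σ, (f σ - c) = 0 := by
    rw [Finset.sum_sub_distrib, hc]
    simp [Fintype.card_perm]
  have hre := H d (fun σ => (f σ - c).re) v hv0 (fun σ => (localVariation_le_of_norm_le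
    (fun σ τ => by
      have := Complex.abs_re_le_norm (f σ - f τ)
      simpa using this) σ).trans (hv σ)) (by
      rw [← Complex.re_sum, h0, Complex.zero_re])
  have him := H d (fun σ => (f σ - c).im) v hv0 (fun σ => (localVariation_le_of_norm_le
    (fun σ τ => by
      have := Complex.abs_im_le_norm (f σ - f τ)
      simpa using this) σ).trans (hv σ)) (by
      rw [← Complex.im_sum, h0, Complex.zero_im])
  have hcard : ((Finset.univ.filter fun σ => t ≤ ‖f σ - c‖).card : ℝ) * (t ^ 2) ^ (2 ^ j) ≤
      ∑ σ, (‖f σ - c‖ ^ 2) ^ (2 ^ j) := by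
    rw [← nsmul_eq_mul]
    refine (Finset.card_nsmul_le_sum _ (fun σ => (‖f σ - c‖ ^ 2) ^ (2 ^ j)) _
      fun σ hσ => ?_).trans ?_
    · have := (Finset.mem_filter.1 hσ).2
      gcongr
    · exact Finset.sum_le_sum_of_subset_of_nonneg (Finset.filter_subset _ _)
        fun σ _ _ => by positivity
  have hsum : ∑ σ, (‖f σ - c‖ ^ 2) ^ (2 ^ j) ≤ 2 ^ (2 ^ j) *
      (∑ σ, ((f σ - c).re ^ 2) ^ (2 ^ j) + ∑ σ, ((f σ - c).im ^ 2) ^ (2 ^ j)) := by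
    rw [← Finset.sum_add_distrib, Finset.mul_sum]
    refine Finset.sum_le_sum fun σ _ => ?_
    have e : ‖f σ - c‖ ^ 2 = (f σ - c).re ^ 2 + (f σ - c).im ^ 2 := by
      rw [← Complex.normSq_eq_norm_sq, Complex.normSq_apply]; ring
    rw [e]
    refine (add_pow_le (sq_nonneg _) (sq_nonneg _) _).trans ?_
    gcongr
    · norm_num
    · exact Nat.sub_le _ _
  have ht' : 0 < (t ^ 2) ^ (2 ^ j) := by positivity
  rw [div_pow, ← mul_div_assoc, ← mul_div_assoc, le_div_iff₀ ht']
  refine (hcard.trans hsum).trans ?_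
  have : (0 : ℝ) < 2 ^ (2 ^ j) := by positivity
  nlinarith

end Tail

/-! ### Spectral norm estimates -/

section SpectralNorm

open scoped Matrix.Norms.L2Operator

lemma specNorm_eq_l2_opNorm {m n : ℕ} (A : Matrix (Fin m) (Fin n) ℂ) : specNorm A = ‖A‖ := rfl

lemma specNorm_nonneg {m n : ℕ} (A : Matrix (Fin m) (Fin n) ℂ) : 0 ≤ specNorm A := norm_nonneg _

lemma specNorm_mul_le {l m n : ℕ} (A : Matrix (Fin l) (Fin m) ℂ) (B : Matrix (Fin m) (Fin n) ℂ) :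
    specNorm (A * B) ≤ specNorm A * specNorm B :=
  Matrix.l2_opNorm_mul A B

lemma specNorm_conjTranspose {m n : ℕ} (A : Matrix (Fin m) (Fin n) ℂ) :
    specNorm Aᴴ = specNorm A :=
  Matrix.l2_opNorm_conjTranspose A

lemma specNorm_one_le (n : ℕ) : specNorm (1 : Matrix (Fin n) (Fin n) ℂ) ≤ 1 := by
  refine ContinuousLinearMap.opNorm_le_bound _ zero_le_one fun x => ?_
  simp

lemma specNorm_pow_le {n : ℕ} (B : Matrix (Fin n) (Fin n) ℂ) (k : ℕ) :
    specNorm (B ^ k) ≤ specNorm B ^ k := by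
  induction k with
  | zero => simpa using specNorm_one_le n
  | succ k ih =>
    rw [pow_succ, pow_succ]
    exact (specNorm_mul_le _ _).trans (mul_le_mul_of_nonneg_right ih (specNorm_nonneg _))

lemma specNorm_unitary_le {n : ℕ} {U : Matrix (Fin n) (Fin n) ℂ}
    (hU : U ∈ Matrix.unitaryGroup (Fin n) ℂ) : specNorm U ≤ 1 := by
  have h : specNorm (Uᴴ * U) = specNorm U * specNorm U := Matrix.l2_opNorm_conjTranspose_mul_self U
  rw [show Uᴴ * U = 1 from Matrix.mem_unitaryGroup_iff'.1 hU] at h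
  nlinarith [specNorm_one_le n, specNorm_nonneg U]

lemma sum_sq_mulVec_le {m n : ℕ} (B : Matrix (Fin m) (Fin n) ℂ) (x : Fin n → ℂ) :
    ∑ i, ‖(B *ᵥ x) i‖ ^ 2 ≤ specNorm B ^ 2 * ∑ i, ‖x i‖ ^ 2 := by
  have h := Matrix.l2_opNorm_mulVec B (WithLp.toLp 2 x)
  have h2 := pow_le_pow_left₀ (norm_nonneg _) h 2
  rw [mul_pow, EuclideanSpace.norm_sq_eq, EuclideanSpace.norm_sq_eq] at h2
  simpa [specNorm_eq_l2_opNorm] using h2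

lemma sum_sq_vecMul_le {m n : ℕ} (B : Matrix (Fin m) (Fin n) ℂ) (x : Fin m → ℂ) :
    ∑ i, ‖(x ᵥ* B) i‖ ^ 2 ≤ specNorm B ^ 2 * ∑ i, ‖x i‖ ^ 2 := by
  have h := sum_sq_mulVec_le Bᴴ (star x)
  rw [← Matrix.star_vecMul, specNorm_conjTranspose] at h
  simpa using h

lemma norm_entry_le_specNorm {m n : ℕ} (B : Matrix (Fin m) (Fin n) ℂ) (i : Fin m) (j : Fin n) :
    ‖B i j‖ ≤ specNorm B := by
  have h := sum_sq_mulVec_le B (Pi.single j 1)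
  have h1 : ∑ i, ‖(Pi.single j (1 : ℂ) : Fin n → ℂ) i‖ ^ 2 = 1 := by
    rw [Finset.sum_eq_single j] <;> simp +contextual
  have h2 : ‖B i j‖ ^ 2 ≤ ∑ i, ‖(B *ᵥ Pi.single j 1) i‖ ^ 2 := by
    have := Finset.single_le_sum (f := fun i => ‖(B *ᵥ Pi.single j 1) i‖ ^ 2)
      (fun i _ => sq_nonneg _) (Finset.mem_univ i)
    simpa using this
  rw [h1, mul_one] at h
  exact le_of_sq_le_sq (h2.trans h) (specNorm_nonneg B)

end SpectralNorm

/-! ### Row and column sums of the transposition weights -/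

section Weights

lemma sum_swapWeight_right_le {d : ℕ} (k : Fin d) : ∑ l, swapWeight k l ≤ 1 / 2 := by
  have hk : (0 : ℝ) < (d : ℝ) - (k : ℕ) := by
    have : ((k : ℕ) : ℝ) < d := by exact_mod_cast k.2
    linarith
  have h : ∑ l, swapWeight k l = ((d - 1 - k : ℕ) : ℝ) * (1 / (2 * ((d : ℝ) - (k : ℕ)))) := by
    unfold swapWeight
    rw [← Finset.sum_filter, Finset.sum_const, nsmul_eq_mul]
    congr 2
    rw [show (Finset.univ.filter fun l => k < l) = Finset.Ioi k by ext; simp, Fin.card_Ioi]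
  have h2 : ((d - 1 - k : ℕ) : ℝ) ≤ (d : ℝ) - (k : ℕ) := by
    have : (d - 1 - k : ℕ) + (k : ℕ) ≤ d := by have := k.2; omega
    have : ((d - 1 - k : ℕ) : ℝ) + ((k : ℕ) : ℝ) ≤ d := by exact_mod_cast this
    linarith
  rw [h, mul_one_div, div_le_iff₀ (by positivity)]
  linarith

/-- Dropping the condition `k < l` leaves half a harmonic sum. Row sums are bounded, so this is the
only source of the logarithm. -/
lemma sum_swapWeight_left_le {d : ℕ} (l : Fin d) :
    ∑ k, swapWeight k l ≤ (1 + Real.log d) / 2 := by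
  have h1 : ∑ k, swapWeight k l ≤ ∑ k : Fin d, 1 / (2 * ((d : ℝ) - (k : ℕ))) := by
    refine Finset.sum_le_sum fun k _ => ?_
    have : 0 < (d : ℝ) - (k : ℕ) := by
      have : ((k : ℕ) : ℝ) < d := by exact_mod_cast k.2
      linarith
    unfold swapWeight
    split_ifs
    · exact le_rfl
    · positivity
  have h2 : ∑ k : Fin d, 1 / (2 * ((d : ℝ) - (k : ℕ))) = ((harmonic d : ℚ) : ℝ) / 2 := by
    rw [Fin.sum_univ_eq_sum_range (fun k => 1 / (2 * ((d : ℝ) - (k : ℕ)))) d,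
      ← Finset.sum_range_reflect, harmonic]
    push_cast
    rw [Finset.sum_div]
    refine Finset.sum_congr rfl fun i hi => ?_
    have hi := Finset.mem_range.1 hi
    have : ((d - 1 - i : ℕ) : ℝ) = (d : ℝ) - 1 - i := by
      rw [Nat.cast_sub (by omega), Nat.cast_sub (by omega), Nat.cast_one]
    rw [this, show (d : ℝ) - (d - 1 - i) = i + 1 by ring]
    field_simp
  rw [h2] at h1
  have := harmonic_le_one_add_log d
  linarith

lemma sum_swapWeight_mul_add_le {d : ℕ} {x : Fin d → ℝ} (hx : ∀ i, 0 ≤ x i) :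
    ∑ k, ∑ l, swapWeight k l * (x k + x l) ≤ (2 + Real.log d) / 2 * ∑ i, x i := by
  have h1 : ∑ k, ∑ l, swapWeight k l * x k ≤ 1 / 2 * ∑ i, x i := by
    rw [Finset.mul_sum]
    refine Finset.sum_le_sum fun k _ => ?_
    rw [← Finset.sum_mul]
    exact mul_le_mul_of_nonneg_right (sum_swapWeight_right_le k) (hx k)
  have h2 : ∑ k, ∑ l, swapWeight k l * x l ≤ (1 + Real.log d) / 2 * ∑ i, x i := by
    rw [Finset.mul_sum, Finset.sum_comm]
    refine Finset.sum_le_sum fun k _ => ?_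
    rw [← Finset.sum_mul]
    exact mul_le_mul_of_nonneg_right (sum_swapWeight_left_le k) (hx k)
  simp only [mul_add, Finset.sum_add_distrib]
  linarith

lemma sum_swapWeight_le (d : ℕ) : ∑ k : Fin d, ∑ l, swapWeight k l ≤ d / 2 := by
  refine (Finset.sum_le_sum fun k _ => sum_swapWeight_right_le k).trans_eq ?_
  simp
  ring

end Weights

/-! ### Local variation of a permuted sesquilinear form -/

section PermForm

/-- The sesquilinear form of `B` at the vectors `u` and `v` permuted by `σ`. -/
noncomputable def permForm {d : ℕ} (B : Matrix (Fin d) (Fin d) ℂ) (u v : Fin d → ℂ)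
    (σ : Equiv.Perm (Fin d)) : ℂ :=
  star (u ∘ σ) ⬝ᵥ (B *ᵥ (v ∘ σ))

lemma comp_swap_eq {d : ℕ} (a : Fin d → ℂ) (k l : Fin d) :
    a ∘ Equiv.swap k l = a + (a l - a k) • (Pi.single k 1 - Pi.single l 1) := by
  ext i
  simp only [Function.comp_apply, Pi.add_apply, Pi.smul_apply, Pi.sub_apply, smul_eq_mul]
  rcases eq_or_ne i k with rfl | hk
  · rcases eq_or_ne i l with rfl | hl
    · simp
    · simp [hl]
  · rcases eq_or_ne i l with rfl | hl
    · simp [hk]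
    · simp [hk, hl, Equiv.swap_apply_of_ne_of_ne]

/-- A transposition moves a vector along `e_k - e_l`, so the form changes by two first-order terms,
visible in `B b` and `aᴴ B`, and one second-order term in four entries of `B`. -/
lemma form_comp_swap_sub {d : ℕ} (B : Matrix (Fin d) (Fin d) ℂ) (a b : Fin d → ℂ) (k l : Fin d) :
    star (a ∘ Equiv.swap k l) ⬝ᵥ (B *ᵥ (b ∘ Equiv.swap k l)) - star a ⬝ᵥ (B *ᵥ b) =
      star (a l - a k) * ((B *ᵥ b) k - (B *ᵥ b) l) +
      (b l - b k) * ((star a ᵥ* B) k - (star a ᵥ* B) l) +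
      star (a l - a k) * (b l - b k) * (B k k - B k l - B l k + B l l) := by
  have hs : star (Pi.single k 1 - Pi.single l 1 : Fin d → ℂ) = Pi.single k 1 - Pi.single l 1 := by
    rw [star_sub, ← Pi.single_star, ← Pi.single_star, star_one]
  rw [comp_swap_eq, comp_swap_eq, star_add, star_smul, hs, Matrix.mulVec_add, Matrix.mulVec_smul,
    add_dotProduct, dotProduct_add, dotProduct_add, smul_dotProduct, smul_dotProduct,
    dotProduct_smul, dotProduct_smul, Matrix.dotProduct_mulVec (star a) B (_ - _)]
  simp only [sub_dotProduct, dotProduct_sub, single_one_dotProduct, dotProduct_single_one,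
    Matrix.mulVec_sub, Matrix.mulVec_single_one, smul_eq_mul, Matrix.col_apply]
  ring

lemma norm_sub_sq_le (x y : ℂ) : ‖x - y‖ ^ 2 ≤ 2 * (‖x‖ ^ 2 + ‖y‖ ^ 2) := by
  have := norm_sub_le x y
  have h := pow_le_pow_left₀ (norm_nonneg _) this 2
  nlinarith [sq_nonneg (‖x‖ - ‖y‖)]

lemma norm_add_three_sq_le (x y z : ℂ) :
    ‖x + y + z‖ ^ 2 ≤ 3 * (‖x‖ ^ 2 + ‖y‖ ^ 2 + ‖z‖ ^ 2) := by
  have h := pow_le_pow_left₀ (norm_nonneg _) (norm_add₃_le (a := x) (b := y) (c := z)) 2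
  nlinarith [sq_nonneg (‖x‖ - ‖y‖), sq_nonneg (‖y‖ - ‖z‖), sq_nonneg (‖x‖ - ‖z‖)]

lemma norm_form_comp_swap_sub_sq_le {d : ℕ} (B : Matrix (Fin d) (Fin d) ℂ) (a b : Fin d → ℂ)
    {μ : ℝ} (ha : ∀ i, ‖a i‖ ≤ μ) (hb : ∀ i, ‖b i‖ ≤ μ) (k l : Fin d) :
    ‖star a ⬝ᵥ (B *ᵥ b) - star (a ∘ Equiv.swap k l) ⬝ᵥ (B *ᵥ (b ∘ Equiv.swap k l))‖ ^ 2 ≤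
      24 * μ ^ 2 * (‖(B *ᵥ b) k‖ ^ 2 + ‖(B *ᵥ b) l‖ ^ 2) +
      24 * μ ^ 2 * (‖(star a ᵥ* B) k‖ ^ 2 + ‖(star a ᵥ* B) l‖ ^ 2) +
      768 * μ ^ 4 * specNorm B ^ 2 := by
  have hμ : 0 ≤ μ := (norm_nonneg _).trans (ha k)
  rw [norm_sub_rev, form_comp_swap_sub]
  refine (norm_add_three_sq_le _ _ _).trans ?_
  have hα : ‖star (a l - a k)‖ ≤ 2 * μ := by
    rw [norm_star]
    exact (norm_sub_le _ _).trans (by linarith [ha l, ha k])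
  have hβ : ‖b l - b k‖ ≤ 2 * μ := (norm_sub_le _ _).trans (by linarith [hb l, hb k])
  have h3 : ‖B k k - B k l - B l k + B l l‖ ≤ 4 * specNorm B := by
    have h := norm_add_le (B k k - B k l - B l k) (B l l)
    have h' := norm_sub_le (B k k - B k l) (B l k)
    have h'' := norm_sub_le (B k k) (B k l)
    linarith [norm_entry_le_specNorm B k k, norm_entry_le_specNorm B k l,
      norm_entry_le_specNorm B l k, norm_entry_le_specNorm B l l]
  simp only [norm_mul, mul_pow]
  have i1 : ‖star (a l - a k)‖ ^ 2 * ‖(B *ᵥ b) k - (B *ᵥ b) l‖ ^ 2 ≤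
      (2 * μ) ^ 2 * (2 * (‖(B *ᵥ b) k‖ ^ 2 + ‖(B *ᵥ b) l‖ ^ 2)) := by
    gcongr
    exact norm_sub_sq_le _ _
  have i2 : ‖b l - b k‖ ^ 2 * ‖(star a ᵥ* B) k - (star a ᵥ* B) l‖ ^ 2 ≤
      (2 * μ) ^ 2 * (2 * (‖(star a ᵥ* B) k‖ ^ 2 + ‖(star a ᵥ* B) l‖ ^ 2)) := by
    gcongr
    exact norm_sub_sq_le _ _
  have i3 : ‖star (a l - a k)‖ ^ 2 * ‖b l - b k‖ ^ 2 *
      ‖B k k - B k l - B l k + B l l‖ ^ 2 ≤ (2 * μ) ^ 2 * (2 * μ) ^ 2 * (4 * specNorm B) ^ 2 := by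
    gcongr
  linarith

/-- The gain comes from summing the first-order terms in `ℓ²`, where `B v` and `uᴴ B` have norm at
most `specNorm B`. Only the second-order term is bounded entrywise, at the cost of the total weight
`d / 2`. -/
lemma localVariation_permForm_le {d : ℕ} (B : Matrix (Fin d) (Fin d) ℂ) (u v : Fin d → ℂ)
    {μ : ℝ} (hu : ∀ i, ‖u i‖ ≤ μ) (hv : ∀ i, ‖v i‖ ≤ μ) (hu1 : ∑ i, ‖u i‖ ^ 2 ≤ 1)
    (hv1 : ∑ i, ‖v i‖ ^ 2 ≤ 1) (σ : Equiv.Perm (Fin d)) :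
    localVariation (permForm B u v) σ ≤
      specNorm B ^ 2 * (24 * μ ^ 2 * (2 + Real.log d) + 384 * d * μ ^ 4) := by
  have hlog : 0 ≤ Real.log d := Real.log_natCast_nonneg d
  have hBb : ∑ i, ‖(B *ᵥ (v ∘ σ)) i‖ ^ 2 ≤ specNorm B ^ 2 := by
    refine (sum_sq_mulVec_le B _).trans (mul_le_of_le_one_right (sq_nonneg _) ?_)
    exact (Equiv.sum_comp σ fun i => ‖v i‖ ^ 2).trans_le hv1
  have haB : ∑ i, ‖(star (u ∘ σ) ᵥ* B) i‖ ^ 2 ≤ specNorm B ^ 2 := by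
    refine (sum_sq_vecMul_le B _).trans (mul_le_of_le_one_right (sq_nonneg _) ?_)
    simp only [Pi.star_apply, norm_star]
    exact (Equiv.sum_comp σ fun i => ‖u i‖ ^ 2).trans_le hu1
  have h1 := sum_swapWeight_mul_add_le (x := fun i => ‖(B *ᵥ (v ∘ σ)) i‖ ^ 2)
    (fun _ => sq_nonneg _)
  have h2 := sum_swapWeight_mul_add_le (x := fun i => ‖(star (u ∘ σ) ᵥ* B) i‖ ^ 2)
    (fun _ => sq_nonneg _)
  calc localVariation (permForm B u v) σ
      ≤ ∑ k, ∑ l, swapWeight k l * (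
        24 * μ ^ 2 * (‖(B *ᵥ (v ∘ σ)) k‖ ^ 2 + ‖(B *ᵥ (v ∘ σ)) l‖ ^ 2) +
        24 * μ ^ 2 * (‖(star (u ∘ σ) ᵥ* B) k‖ ^ 2 + ‖(star (u ∘ σ) ᵥ* B) l‖ ^ 2) +
        768 * μ ^ 4 * specNorm B ^ 2) := by
        unfold localVariation
        gcongr with k _ l _
        · exact swapWeight_nonneg _ _
        · exact norm_form_comp_swap_sub_sq_le B (u ∘ σ) (v ∘ σ) (fun i => hu _) (fun i => hv _) k l
    _ = 24 * μ ^ 2 * (∑ k, ∑ l, swapWeight k l *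
          (‖(B *ᵥ (v ∘ σ)) k‖ ^ 2 + ‖(B *ᵥ (v ∘ σ)) l‖ ^ 2)) +
        24 * μ ^ 2 * (∑ k, ∑ l, swapWeight k l *
          (‖(star (u ∘ σ) ᵥ* B) k‖ ^ 2 + ‖(star (u ∘ σ) ᵥ* B) l‖ ^ 2)) +
        768 * μ ^ 4 * specNorm B ^ 2 * ∑ k : Fin d, ∑ l, swapWeight k l := by
        simp only [Finset.mul_sum, ← Finset.sum_add_distrib]
        refine Finset.sum_congr rfl fun k _ => Finset.sum_congr rfl fun l _ => ?_
        ring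
    _ ≤ 24 * μ ^ 2 * ((2 + Real.log d) / 2 * specNorm B ^ 2) +
        24 * μ ^ 2 * ((2 + Real.log d) / 2 * specNorm B ^ 2) +
        768 * μ ^ 4 * specNorm B ^ 2 * (d / 2) := by
        gcongr
        · refine h1.trans ?_
          gcongr
        · refine h2.trans ?_
          gcongr
        · exact sum_swapWeight_le d
    _ = _ := by ring

end PermForm

/-! ### Average of the form over all permutations -/

section Mean

lemma sum_perm_apply_eq {d : ℕ} (F : Fin d → Fin d → ℂ) (ρ : Equiv.Perm (Fin d)) (a b : Fin d) :
    ∑ σ : Equiv.Perm (Fin d), F (σ (ρ a)) (σ (ρ b)) =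
      ∑ σ : Equiv.Perm (Fin d), F (σ a) (σ b) :=
  Equiv.sum_comp (Equiv.mulRight ρ) fun σ : Equiv.Perm (Fin d) => F (σ a) (σ b)

lemma exists_perm_apply_eq {α : Type*} [DecidableEq α] {a b a' b' : α} (h : a ≠ b)
    (h' : a' ≠ b') : ∃ ρ : Equiv.Perm α, ρ a = a' ∧ ρ b = b' := by
  refine ⟨Equiv.swap (Equiv.swap a a' b) b' * Equiv.swap a a', ?_, ?_⟩
  · rw [Equiv.Perm.mul_apply, Equiv.swap_apply_left]
    refine Equiv.swap_apply_of_ne_of_ne (fun hh => h ?_) h'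
    rw [eq_comm, Equiv.swap_apply_eq_iff, Equiv.swap_apply_right] at hh
    exact hh.symm
  · rw [Equiv.Perm.mul_apply, Equiv.swap_apply_left]

lemma card_mul_sum_perm_apply {d : ℕ} (F : Fin d → ℂ) (a : Fin d) :
    (d : ℂ) * ∑ σ : Equiv.Perm (Fin d), F (σ a) = d.factorial * ∑ i, F i := by
  have h : ∀ b, ∑ σ : Equiv.Perm (Fin d), F (σ b) = ∑ σ : Equiv.Perm (Fin d), F (σ a) := by
    intro b
    have := sum_perm_apply_eq (fun i _ => F i) (Equiv.swap a b) a a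
    simpa using this
  have h2 : ∑ b, ∑ σ : Equiv.Perm (Fin d), F (σ b) = d.factorial * ∑ i, F i := by
    rw [Finset.sum_comm]
    simp only [Equiv.sum_comp _ F]
    simp [Fintype.card_perm]
  rw [← h2]
  simp [h]

lemma sum_sum_ite_ne_const (d : ℕ) (c : ℂ) :
    ∑ i : Fin d, ∑ j : Fin d, (if i ≠ j then c else 0) = (d : ℂ) * ((d : ℂ) - 1) * c := by
  have : ∀ i : Fin d, ∑ j : Fin d, (if i ≠ j then c else 0) = ((d : ℂ) - 1) * c := by
    intro i
    have h : ∀ j : Fin d, (if i ≠ j then c else 0) = c - if i = j then c else 0 := by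
      intro j; split_ifs <;> simp_all
    simp only [h, Finset.sum_sub_distrib]
    simp
    ring
  simp only [this]
  simp [mul_assoc]

/-- By double transitivity the sum over `σ` is the same for every pair of distinct indices, so it
can be averaged over all `d (d - 1)` of them. -/
lemma card_mul_sum_perm_apply_apply {d : ℕ} (F : Fin d → Fin d → ℂ) {a b : Fin d} (hab : a ≠ b) :
    (d : ℂ) * ((d : ℂ) - 1) * ∑ σ : Equiv.Perm (Fin d), F (σ a) (σ b) =
      d.factorial * ∑ i, ∑ j, if i ≠ j then F i j else 0 := by
  rw [← sum_sum_ite_ne_const]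
  have h : ∀ i j : Fin d, (if i ≠ j then ∑ σ : Equiv.Perm (Fin d), F (σ a) (σ b) else 0) =
      ∑ σ : Equiv.Perm (Fin d), if σ i ≠ σ j then F (σ i) (σ j) else 0 := by
    intro i j
    by_cases hij : i = j
    · simp [hij]
    · obtain ⟨ρ, rfl, rfl⟩ := exists_perm_apply_eq hab hij
      simp only [ne_eq, EmbeddingLike.apply_eq_iff_eq, hab, not_false_eq_true, if_true]
      exact (sum_perm_apply_eq F ρ a b).symm
  simp only [h]
  have h2 : ∀ σ : Equiv.Perm (Fin d),
      ∑ i, ∑ j, (if σ i ≠ σ j then F (σ i) (σ j) else 0) =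
      ∑ i, ∑ j, if i ≠ j then F i j else 0 := by
    intro σ
    rw [← Equiv.sum_comp σ fun i => ∑ j, if i ≠ j then F i j else 0]
    refine Finset.sum_congr rfl fun i _ => ?_
    rw [← Equiv.sum_comp σ fun j => if σ i ≠ j then F (σ i) j else 0]
  calc _ = ∑ i, ∑ σ : Equiv.Perm (Fin d), ∑ j, (if σ i ≠ σ j then F (σ i) (σ j) else 0) :=
        Finset.sum_congr rfl fun i _ => Finset.sum_comm
    _ = ∑ σ : Equiv.Perm (Fin d), ∑ i, ∑ j, (if σ i ≠ σ j then F (σ i) (σ j) else 0) :=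
        Finset.sum_comm
    _ = _ := by simp only [h2]; simp [Fintype.card_perm]

/-- The sum of all off-diagonal entries. -/
noncomputable def offDiagSum {d : ℕ} (B : Matrix (Fin d) (Fin d) ℂ) : ℂ :=
  ∑ i, ∑ j, if i ≠ j then B i j else 0

lemma permForm_eq_sum {d : ℕ} (B : Matrix (Fin d) (Fin d) ℂ) (u v : Fin d → ℂ)
    (σ : Equiv.Perm (Fin d)) :
    permForm B u v σ = ∑ i, B i i * (star (u (σ i)) * v (σ i)) +
      ∑ i, ∑ j, (if i ≠ j then B i j else 0) * (star (u (σ i)) * v (σ j)) := by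
  rw [← Finset.sum_add_distrib]
  unfold permForm dotProduct
  refine Finset.sum_congr rfl fun i _ => ?_
  have : ∑ j, (if i ≠ j then B i j else 0) * (star (u (σ i)) * v (σ j)) =
      ∑ j, B i j * (star (u (σ i)) * v (σ j)) - B i i * (star (u (σ i)) * v (σ i)) := by
    rw [eq_sub_iff_add_eq, ← Finset.sum_erase_add _ _ (Finset.mem_univ i),
      ← Finset.sum_erase_add (f := fun j => B i j * _) _ (Finset.mem_univ i)]
    simp only [ne_eq, not_true_eq_false, if_false, zero_mul, add_zero]
    congr 1
    refine Finset.sum_congr rfl fun j hj => ?_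
    rw [if_pos (Finset.ne_of_mem_erase hj).symm]
  rw [this, add_sub_cancel, Matrix.mulVec, dotProduct, Finset.mul_sum]
  refine Finset.sum_congr rfl fun j _ => ?_
  simp
  ring

lemma sum_permForm {d : ℕ} (hd : 2 ≤ d) (B : Matrix (Fin d) (Fin d) ℂ) (u v : Fin d → ℂ) :
    ∑ σ, permForm B u v σ = d.factorial *
      (B.trace / d * ∑ i, star (u i) * v i +
        offDiagSum B * (∑ i, ∑ j, if i ≠ j then star (u i) * v j else 0) /
          ((d : ℂ) * ((d : ℂ) - 1))) := by
  have hd0 : (d : ℂ) ≠ 0 := by exact_mod_cast (by omega : d ≠ 0)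
  have hd1 : (d : ℂ) - 1 ≠ 0 := by
    rw [sub_ne_zero]; exact_mod_cast (by omega : d ≠ 1)
  simp only [permForm_eq_sum, Finset.sum_add_distrib]
  rw [mul_add]
  congr 1
  · rw [Finset.sum_comm]
    simp only [← Finset.mul_sum]
    have h : ∀ a : Fin d, ∑ σ : Equiv.Perm (Fin d), star (u (σ a)) * v (σ a) =
        d.factorial * (∑ i, star (u i) * v i) / d := by
      intro a
      rw [eq_div_iff hd0, mul_comm]
      exact card_mul_sum_perm_apply (fun i => star (u i) * v i) a
    simp only [h, ← Finset.sum_mul, Matrix.trace, Matrix.diag_apply]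
    ring
  · rw [Finset.sum_comm]
    have h : ∀ a b : Fin d, ∑ σ : Equiv.Perm (Fin d),
        (if a ≠ b then B a b else 0) * (star (u (σ a)) * v (σ b)) =
        (if a ≠ b then B a b else 0) * (d.factorial *
          (∑ i, ∑ j, if i ≠ j then star (u i) * v j else 0) / ((d : ℂ) * ((d : ℂ) - 1))) := by
      intro a b
      rw [← Finset.mul_sum]
      by_cases hab : a = b
      · simp [hab]
      · congr 1
        rw [eq_div_iff (mul_ne_zero hd0 hd1), mul_comm]
        exact card_mul_sum_perm_apply_apply (fun i j => star (u i) * v j) hab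
    have h' : ∀ a : Fin d, ∑ σ : Equiv.Perm (Fin d), ∑ b,
        (if a ≠ b then B a b else 0) * (star (u (σ a)) * v (σ b)) =
        (∑ b, if a ≠ b then B a b else 0) * (d.factorial *
          (∑ i, ∑ j, if i ≠ j then star (u i) * v j else 0) / ((d : ℂ) * ((d : ℂ) - 1))) := by
      intro a
      rw [Finset.sum_comm]
      simp only [h, Finset.sum_mul]
    simp only [h', ← Finset.sum_mul, offDiagSum]
    ring

lemma norm_sum_sq_le {d : ℕ} {u : Fin d → ℂ} (hu : ∑ i, ‖u i‖ ^ 2 ≤ 1) :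
    ‖∑ i, u i‖ ^ 2 ≤ d := by
  have h1 := pow_le_pow_left₀ (norm_nonneg _) (norm_sum_le Finset.univ u) 2
  have h2 := sq_sum_le_card_mul_sum_sq (s := (Finset.univ : Finset (Fin d))) (f := fun i => ‖u i‖)
  simp only [Finset.card_univ, Fintype.card_fin] at h2
  have h3 : (d : ℝ) * ∑ i, ‖u i‖ ^ 2 ≤ d := mul_le_of_le_one_right (by positivity) hu
  linarith

lemma norm_sum_star_mul_le {d : ℕ} {u v : Fin d → ℂ} (hu : ∑ i, ‖u i‖ ^ 2 ≤ 1)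
    (hv : ∑ i, ‖v i‖ ^ 2 ≤ 1) : ‖∑ i, star (u i) * v i‖ ≤ 1 := by
  refine (norm_sum_le _ _).trans ?_
  have : ∀ i, ‖star (u i) * v i‖ ≤ (‖u i‖ ^ 2 + ‖v i‖ ^ 2) / 2 := by
    intro i
    rw [norm_mul, norm_star]
    nlinarith [sq_nonneg (‖u i‖ - ‖v i‖)]
  refine (Finset.sum_le_sum fun i _ => this i).trans ?_
  rw [← Finset.sum_div, Finset.sum_add_distrib]
  linarith

/-- The full double sum factors into two sums of modulus at most `√d`; removing the diagonal costs
at most `1`. -/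
lemma norm_sum_ne_star_mul_le {d : ℕ} {u v : Fin d → ℂ} (hu : ∑ i, ‖u i‖ ^ 2 ≤ 1)
    (hv : ∑ i, ‖v i‖ ^ 2 ≤ 1) :
    ‖∑ i, ∑ j, if i ≠ j then star (u i) * v j else 0‖ ≤ d + 1 := by
  have h : (∑ i, ∑ j, if i ≠ j then star (u i) * v j else 0) =
      star (∑ i, u i) * (∑ j, v j) - ∑ i, star (u i) * v i := by
    rw [star_sum, Finset.sum_mul_sum, ← Finset.sum_sub_distrib]
    refine Finset.sum_congr rfl fun i _ => ?_
    have h : ∀ j, (if i ≠ j then star (u i) * v j else 0) =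
        star (u i) * v j - if i = j then star (u i) * v j else 0 := by
      intro j; split_ifs <;> simp_all
    simp only [h, Finset.sum_sub_distrib]
    simp
  rw [h]
  refine (norm_sub_le _ _).trans (add_le_add ?_ (norm_sum_star_mul_le hu hv))
  rw [norm_mul, norm_star]
  nlinarith [norm_sum_sq_le hu, norm_sum_sq_le hv, sq_nonneg (‖∑ i, u i‖ - ‖∑ i, v i‖)]

lemma exists_mean_permForm {d : ℕ} (hd : 2 ≤ d) (B : Matrix (Fin d) (Fin d) ℂ) {u v : Fin d → ℂ}
    (hu : ∑ i, ‖u i‖ ^ 2 ≤ 1) (hv : ∑ i, ‖v i‖ ^ 2 ≤ 1) :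
    ∃ c : ℂ, ∑ σ, permForm B u v σ = d.factorial * c ∧
      ‖c - B.trace / d * ∑ i, star (u i) * v i‖ ≤ 3 * ‖offDiagSum B‖ / d := by
  refine ⟨_, sum_permForm hd B u v, ?_⟩
  rw [add_sub_cancel_left, norm_div, norm_mul]
  have hd' : (2 : ℝ) ≤ d := by exact_mod_cast hd
  have e : ‖(d : ℂ) * ((d : ℂ) - 1)‖ = d * ((d : ℝ) - 1) := by
    rw [show (d : ℂ) * ((d : ℂ) - 1) = ((d * ((d : ℝ) - 1) : ℝ) : ℂ) by push_cast; rfl,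
      Complex.norm_real, Real.norm_of_nonneg]
    nlinarith
  have h := norm_sum_ne_star_mul_le hu hv
  rw [e, div_le_div_iff₀ (by nlinarith) (by linarith)]
  -- The constant `3` comes from `d + 1 ≤ 3 (d - 1)`, which needs `2 ≤ d`.
  have h2 : ‖offDiagSum B‖ * ‖∑ i, ∑ j, if i ≠ j then star (u i) * v j else 0‖ ≤
      ‖offDiagSum B‖ * (3 * (d - 1)) := by
    gcongr
    linarith
  have := mul_le_mul_of_nonneg_right h2 (by linarith : (0 : ℝ) ≤ d)
  linarith

end Mean

/-! ### Gram powers under unitary conjugation -/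

section Conjugation

lemma permMatrix_mul_mem_unitaryGroup {d : ℕ} (σ : Equiv.Perm (Fin d))
    {U : Matrix (Fin d) (Fin d) ℂ} (hU : U ∈ Matrix.unitaryGroup (Fin d) ℂ) :
    σ.permMatrix ℂ * U ∈ Matrix.unitaryGroup (Fin d) ℂ := by
  refine mul_mem ?_ hU
  rw [Matrix.mem_unitaryGroup_iff', Matrix.star_eq_conjTranspose, Matrix.conjTranspose_permMatrix,
    ← Matrix.permMatrix_mul, mul_inv_cancel, Matrix.permMatrix_one]

lemma gram_mul_unitary_pow {m d : ℕ} (A : Matrix (Fin m) (Fin d) ℂ)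
    {T : Matrix (Fin d) (Fin d) ℂ} (hT : T ∈ Matrix.unitaryGroup (Fin d) ℂ) (k : ℕ) :
    ((A * T)ᴴ * (A * T)) ^ k = Tᴴ * (Aᴴ * A) ^ k * T := by
  have h1 : Tᴴ * T = 1 := Matrix.mem_unitaryGroup_iff'.1 hT
  have h2 : T * Tᴴ = 1 := Matrix.mem_unitaryGroup_iff.1 hT
  induction k with
  | zero => simp [h1]
  | succ k ih =>
    rw [pow_succ, ih, Matrix.conjTranspose_mul, pow_succ]
    calc Tᴴ * (Aᴴ * A) ^ k * T * (Tᴴ * Aᴴ * (A * T))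
        = Tᴴ * (Aᴴ * A) ^ k * (T * Tᴴ) * (Aᴴ * A * T) := by simp only [Matrix.mul_assoc]
      _ = _ := by rw [h2, Matrix.mul_one]; simp only [Matrix.mul_assoc]

lemma trace_gram_mul_unitary_pow {m d : ℕ} (A : Matrix (Fin m) (Fin d) ℂ)
    {T : Matrix (Fin d) (Fin d) ℂ} (hT : T ∈ Matrix.unitaryGroup (Fin d) ℂ) (k : ℕ) :
    (((A * T)ᴴ * (A * T)) ^ k).trace = ((Aᴴ * A) ^ k).trace := by
  rw [gram_mul_unitary_pow A hT, Matrix.trace_mul_comm, ← Matrix.mul_assoc,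
    show T * Tᴴ = 1 from Matrix.mem_unitaryGroup_iff.1 hT, Matrix.one_mul]

/-- Row `i` of the permuted matrix is row `σ i` of `U`, so its columns are the columns of `U`
composed with `σ`. -/
lemma conj_permMatrix_mul_apply {d : ℕ} (B U : Matrix (Fin d) (Fin d) ℂ)
    (σ : Equiv.Perm (Fin d)) (a b : Fin d) :
    ((σ.permMatrix ℂ * U)ᴴ * B * (σ.permMatrix ℂ * U)) a b =
      permForm B (fun i => U i a) (fun i => U i b) σ := by
  rw [PEquiv.toMatrix_toPEquiv_mul, Matrix.mul_assoc]
  rfl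

lemma sum_star_mul_col {d : ℕ} {U : Matrix (Fin d) (Fin d) ℂ}
    (hU : U ∈ Matrix.unitaryGroup (Fin d) ℂ) (a b : Fin d) :
    ∑ i, star (U i a) * U i b = (1 : Matrix (Fin d) (Fin d) ℂ) a b := by
  rw [← Matrix.mem_unitaryGroup_iff'.1 hU, Matrix.mul_apply]
  rfl

lemma sum_sq_norm_col {d : ℕ} {U : Matrix (Fin d) (Fin d) ℂ}
    (hU : U ∈ Matrix.unitaryGroup (Fin d) ℂ) (a : Fin d) : ∑ i, ‖U i a‖ ^ 2 = 1 := by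
  have h := sum_star_mul_col hU a a
  rw [Matrix.one_apply_eq] at h
  have h2 : ((∑ i, ‖U i a‖ ^ 2 : ℝ) : ℂ) = 1 := by
    rw [← h]
    push_cast
    refine Finset.sum_congr rfl fun i _ => ?_
    exact (Complex.conj_mul' (U i a)).symm
  exact_mod_cast h2

lemma norm_le_maxNorm {m n : ℕ} (A : Matrix (Fin m) (Fin n) ℂ) (i : Fin m) (j : Fin n) :
    ‖A i j‖ ≤ maxNorm A :=
  le_ciSup (f := fun p : Fin m × Fin n => ‖A p.1 p.2‖) (Set.finite_range _).bddAbove (i, j)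

end Conjugation

/-! ### Union bound over matrix entries -/

section UnionBound

/-- Tail bound for the max norm of a permutation-conjugated matrix around its normalized trace. -/
theorem card_maxNorm_gt_le (j : ℕ) :
    ∃ C : ℝ, 0 < C ∧ ∀ (d : ℕ) (B U : Matrix (Fin d) (Fin d) ℂ) (K μ t : ℝ), 2 ≤ d → 0 < t →
      U ∈ Matrix.unitaryGroup (Fin d) ℂ → maxNorm U ≤ μ → specNorm B ≤ K →
      ((Finset.univ.filter fun σ : Equiv.Perm (Fin d) => t + 3 * ‖offDiagSum B‖ / d <
        maxNorm ((σ.permMatrix ℂ * U)ᴴ * B * (σ.permMatrix ℂ * U) -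
          (B.trace / (d : ℂ)) • (1 : Matrix (Fin d) (Fin d) ℂ))).card : ℝ) ≤
        (d.factorial : ℝ) * (C * d ^ 2 *
          (K ^ 2 * (24 * μ ^ 2 * (2 + Real.log d) + 384 * d * μ ^ 4) / t ^ 2) ^ (2 ^ j)) := by
  obtain ⟨C, hC, H⟩ := card_norm_sub_ge_le j
  refine ⟨C, hC, fun d B U K μ t hd ht hU hμ hK => ?_⟩
  have hlog : 0 ≤ Real.log d := Real.log_natCast_nonneg d
  set v := K ^ 2 * (24 * μ ^ 2 * (2 + Real.log d) + 384 * d * μ ^ 4) with hv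
  have hcol : ∀ a, ∑ i, ‖U i a‖ ^ 2 ≤ 1 := fun a => (sum_sq_norm_col hU a).le
  have hent : ∀ i a, ‖U i a‖ ≤ μ := fun i a => (norm_le_maxNorm U i a).trans hμ
  have hmean := fun a b => exists_mean_permForm hd B (hcol a) (hcol b)
  choose c hc hc' using hmean
  set E : Fin d × Fin d → Finset (Equiv.Perm (Fin d)) := fun p => Finset.univ.filter fun σ =>
    t ≤ ‖permForm B (fun i => U i p.1) (fun i => U i p.2) σ - c p.1 p.2‖ with hE
  have hcard : ∀ p, ((E p).card : ℝ) ≤ d.factorial * (C * (v / t ^ 2) ^ (2 ^ j)) := by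
    intro p
    refine H d _ v t _ (by positivity) ht (fun σ => ?_) (hc p.1 p.2)
    refine (localVariation_permForm_le B _ _ (fun i => hent i _) (fun i => hent i _) (hcol _)
      (hcol _) σ).trans ?_
    have := specNorm_nonneg B
    rw [hv]
    gcongr
  have hsub : (Finset.univ.filter fun σ : Equiv.Perm (Fin d) => t + 3 * ‖offDiagSum B‖ / d <
      maxNorm ((σ.permMatrix ℂ * U)ᴴ * B * (σ.permMatrix ℂ * U) -
        (B.trace / (d : ℂ)) • (1 : Matrix (Fin d) (Fin d) ℂ))) ⊆ Finset.univ.biUnion E := by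
    intro σ hσ
    have hσ := (Finset.mem_filter.1 hσ).2
    by_contra hcon
    simp only [hE, Finset.mem_biUnion, Finset.mem_univ, Finset.mem_filter, true_and, not_exists,
      not_le] at hcon
    refine absurd hσ (not_lt.2 (Real.iSup_le (fun p => ?_) (by positivity)))
    -- Writing the identity entry as an inner product of columns matches the mean estimate and
    -- treats diagonal and off-diagonal entries together.
    rw [Matrix.sub_apply, conj_permMatrix_mul_apply, Matrix.smul_apply, smul_eq_mul,
      ← sum_star_mul_col hU]
    have e := norm_add_le (permForm B (fun i => U i p.1) (fun i => U i p.2) σ - c p.1 p.2)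
      (c p.1 p.2 - B.trace / d * ∑ i, star (U i p.1) * U i p.2)
    rw [sub_add_sub_cancel] at e
    exact e.trans (add_le_add (hcon p).le (hc' p.1 p.2))
  calc _ ≤ ((Finset.univ.biUnion E).card : ℝ) := by exact_mod_cast Finset.card_le_card hsub
    _ ≤ ∑ p, ((E p).card : ℝ) := by exact_mod_cast Finset.card_biUnion_le
    _ ≤ ∑ _p : Fin d × Fin d, d.factorial * (C * (v / t ^ 2) ^ (2 ^ j)) :=
        Finset.sum_le_sum fun p _ => hcard p
    _ = _ := by
        simp
        ring

end UnionBound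

/-! ### Choice of exponents -/

section Asymptotics

/-- With `log d ≤ d^δ / δ` the two terms have exponents `-1 + 3δ` and `-1 + 4δ`; the second
dominates. -/
lemma variance_proxy_le {d : ℕ} (hd : 1 ≤ d) {K c μ δ : ℝ} (hδ : 0 < δ) (hμ0 : 0 ≤ μ)
    (hμ : μ ≤ c * (d : ℝ) ^ (-1 / 2 + δ : ℝ)) :
    K ^ 2 * (24 * μ ^ 2 * (2 + Real.log d) + 384 * d * μ ^ 4) ≤
      K ^ 2 * (24 * c ^ 2 * (2 + 1 / δ) + 384 * c ^ 4) * (d : ℝ) ^ (-1 + 4 * δ : ℝ) := by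
  have hd1 : (1 : ℝ) ≤ d := by exact_mod_cast hd
  have hd0 : (0 : ℝ) < d := by linarith
  have hlog0 : 0 ≤ Real.log d := Real.log_natCast_nonneg d
  have hlog : 2 + Real.log d ≤ (2 + 1 / δ) * (d : ℝ) ^ δ := by
    have h1 := Real.log_le_rpow_div hd0.le hδ
    have h2 := Real.one_le_rpow hd1 hδ.le
    rw [add_mul, one_div_mul_eq_div]
    linarith
  have h2 : μ ^ 2 ≤ c ^ 2 * (d : ℝ) ^ (-1 + 2 * δ : ℝ) := by
    refine (pow_le_pow_left₀ hμ0 hμ 2).trans_eq ?_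
    rw [mul_pow, ← Real.rpow_mul_natCast hd0.le]
    congr 2
    push_cast
    ring
  have h4 : d * μ ^ 4 ≤ c ^ 4 * (d : ℝ) ^ (-1 + 4 * δ : ℝ) := by
    refine (mul_le_mul_of_nonneg_left (pow_le_pow_left₀ hμ0 hμ 4) hd0.le).trans_eq ?_
    rw [mul_pow, ← Real.rpow_mul_natCast hd0.le, mul_left_comm, mul_comm (d : ℝ),
      ← Real.rpow_add_one hd0.ne']
    congr 2
    push_cast
    ring
  have h3 : (d : ℝ) ^ (-1 + 2 * δ : ℝ) * (d : ℝ) ^ δ ≤ (d : ℝ) ^ (-1 + 4 * δ : ℝ) := by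
    rw [← Real.rpow_add hd0]
    exact Real.rpow_le_rpow_of_exponent_le hd1 (by linarith)
  rw [mul_assoc (K ^ 2)]
  refine mul_le_mul_of_nonneg_left ?_ (sq_nonneg K)
  calc 24 * μ ^ 2 * (2 + Real.log d) + 384 * d * μ ^ 4
      = 24 * (μ ^ 2 * (2 + Real.log d)) + 384 * (d * μ ^ 4) := by ring
    _ ≤ 24 * (c ^ 2 * (d : ℝ) ^ (-1 + 2 * δ : ℝ) * ((2 + 1 / δ) * (d : ℝ) ^ δ)) +
        384 * (c ^ 4 * (d : ℝ) ^ (-1 + 4 * δ : ℝ)) := by gcongr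
    _ = 24 * c ^ 2 * (2 + 1 / δ) * ((d : ℝ) ^ (-1 + 2 * δ : ℝ) * (d : ℝ) ^ δ) +
        384 * c ^ 4 * (d : ℝ) ^ (-1 + 4 * δ : ℝ) := by ring
    _ ≤ 24 * c ^ 2 * (2 + 1 / δ) * (d : ℝ) ^ (-1 + 4 * δ : ℝ) +
        384 * c ^ 4 * (d : ℝ) ^ (-1 + 4 * δ : ℝ) := by gcongr
    _ = _ := by ring

/-- The ratio is at most `c d^{-ε}`, and `4 ≤ ε p` makes its power `O(d⁻⁴)`: two orders pay for the
union bound and two remain for summability. -/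
lemma sq_mul_ratio_pow_le {d : ℕ} (hd : 1 ≤ d) {v c ε : ℝ} {p : ℕ} (hv : 0 ≤ v) (hc : 0 ≤ c)
    (hvc : v ≤ c * (d : ℝ) ^ (-1 + ε : ℝ)) (hp : 4 ≤ ε * p) :
    (d : ℝ) ^ 2 * (v / ((d : ℝ) ^ (-1 / 2 + ε : ℝ)) ^ 2) ^ p ≤ c ^ p * ((d : ℝ) ^ 2)⁻¹ := by
  have hd1 : (1 : ℝ) ≤ d := by exact_mod_cast hd
  have hd0 : (0 : ℝ) < d := by linarith
  have h1 : v / ((d : ℝ) ^ (-1 / 2 + ε : ℝ)) ^ 2 ≤ c * (d : ℝ) ^ (-ε : ℝ) := by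
    rw [div_le_iff₀ (by positivity), mul_assoc, ← Real.rpow_mul_natCast hd0.le,
      ← Real.rpow_add hd0, show -ε + (-1 / 2 + ε) * ((2 : ℕ) : ℝ) = -1 + ε by push_cast; ring]
    exact hvc
  have h2 : (v / ((d : ℝ) ^ (-1 / 2 + ε : ℝ)) ^ 2) ^ p ≤ c ^ p * ((d : ℝ) ^ 4)⁻¹ := by
    refine (pow_le_pow_left₀ (by positivity) h1 p).trans ?_
    rw [mul_pow, ← Real.rpow_mul_natCast hd0.le]
    gcongr
    rw [← Real.rpow_natCast, ← Real.rpow_neg hd0.le]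
    refine Real.rpow_le_rpow_of_exponent_le hd1 ?_
    push_cast
    linarith
  refine (mul_le_mul_of_nonneg_left h2 (by positivity)).trans_eq ?_
  field_simp

/-- Quadratically small failure frequency of the max-norm concentration over all permutations. -/
theorem exists_card_bad_perm_le {M N : ℕ → ℕ} {A : ∀ n, Matrix (Fin (M n)) (Fin (N n)) ℂ}
    (hA_norm : NormBounded A) (hA_off : OffDiagonalSumCondition A)
    {U : ∀ n, Matrix (Fin (N n)) (Fin (N n)) ℂ}
    (hU : ∀ n, U n ∈ Matrix.unitaryGroup (Fin (N n)) ℂ) (hU_deloc : Delocalized U)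
    {k : ℕ} (hk : 1 ≤ k) {ε : ℝ} (hε : 0 < ε) :
    ∃ C₁ > 0, ∃ C₂ > 0, ∃ N₀, 0 < N₀ ∧ ∀ n, N₀ ≤ N n →
      ((Finset.univ.filter fun σ : Equiv.Perm (Fin (N n)) =>
        C₁ * (N n : ℝ) ^ (-1 / 2 + ε : ℝ) <
        maxNorm ((σ.permMatrix ℂ * U n)ᴴ * ((A n)ᴴ * A n) ^ k * (σ.permMatrix ℂ * U n) -
          ((((A n)ᴴ * A n) ^ k).trace / (N n : ℂ)) •
            (1 : Matrix (Fin (N n)) (Fin (N n)) ℂ))).card : ℝ) ≤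
        ((N n).factorial : ℝ) * (C₂ * ((N n : ℝ) ^ 2)⁻¹) := by
  obtain ⟨CA, hCA, NA, _, hA⟩ := hA_norm
  obtain ⟨CS, hCS, NS, _, hS⟩ := hA_off k hk ε hε
  -- The loss `4δ` in the variance proxy then equals `ε`, half of the `2ε` gained from the squared
  -- threshold.
  have hδ : 0 < ε / 4 := by positivity
  obtain ⟨CU, hCU, NU, _, hUd⟩ := hU_deloc (ε / 4) hδ
  obtain ⟨j, hj⟩ : ∃ j : ℕ, 4 ≤ ε * ((2 ^ j : ℕ) : ℝ) := by
    obtain ⟨j, hj⟩ := pow_unbounded_of_one_lt (4 / ε) (one_lt_two (α := ℝ))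
    refine ⟨j, ?_⟩
    rw [div_lt_iff₀ hε] at hj
    push_cast
    linarith
  obtain ⟨C, hC, H⟩ := card_maxNorm_gt_le j
  set K : ℝ := (CA * CA) ^ k with hK
  set c : ℝ := K ^ 2 * (24 * CU ^ 2 * (2 + 1 / (ε / 4)) + 384 * CU ^ 4) with hc
  have hc0 : 0 < c := by positivity
  refine ⟨1 + 3 * CS, by positivity, C * c ^ (2 ^ j), by positivity, NA + NS + NU + 2, by omega,
    fun n hn => ?_⟩
  have hd : 2 ≤ N n := by omega
  have hd1 : (1 : ℝ) ≤ N n := by exact_mod_cast (by omega : 1 ≤ N n)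
  have hd0 : (0 : ℝ) < N n := by linarith
  have hAn : specNorm (A n) ≤ CA := by simpa using hA n (by omega)
  have hSn : ‖offDiagSum (((A n)ᴴ * A n) ^ k)‖ ≤ CS * (N n : ℝ) ^ (1 / 2 + ε : ℝ) :=
    hS n (by omega)
  have hUn := hUd n (by omega)
  have hlog : 0 ≤ Real.log (N n) := Real.log_natCast_nonneg _
  have hB : specNorm (((A n)ᴴ * A n) ^ k) ≤ K := by
    refine (specNorm_pow_le _ _).trans ?_
    have h0 := specNorm_nonneg ((A n)ᴴ * A n)
    have h1 := specNorm_nonneg (A n)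
    rw [hK]
    gcongr
    refine (specNorm_mul_le _ _).trans ?_
    rw [specNorm_conjTranspose]
    gcongr
  have ht : 0 < (N n : ℝ) ^ (-1 / 2 + ε : ℝ) := Real.rpow_pos_of_pos hd0 _
  have hμ0 : 0 ≤ maxNorm (U n) := Real.iSup_nonneg fun _ => norm_nonneg _
  have hthr : (N n : ℝ) ^ (-1 / 2 + ε : ℝ) + 3 * ‖offDiagSum (((A n)ᴴ * A n) ^ k)‖ / N n ≤
      (1 + 3 * CS) * (N n : ℝ) ^ (-1 / 2 + ε : ℝ) := by
    have : ‖offDiagSum (((A n)ᴴ * A n) ^ k)‖ ≤ CS * (N n : ℝ) ^ (-1 / 2 + ε : ℝ) * N n := by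
      refine hSn.trans_eq ?_
      rw [mul_assoc, ← Real.rpow_add_one hd0.ne']
      congr 2
      ring
    rw [add_mul, one_mul, add_le_add_iff_left, div_le_iff₀ hd0]
    linarith
  have hv := variance_proxy_le (K := K) (by omega : 1 ≤ N n) hδ hμ0 hUn
  rw [← hc, mul_div_cancel₀ ε (by norm_num : (4 : ℝ) ≠ 0)] at hv
  have hfin := sq_mul_ratio_pow_le (by omega : 1 ≤ N n) (by positivity) hc0.le hv hj
  refine le_trans ?_ ((H (N n) _ (U n) K _ _ hd ht (hU n) le_rfl hB).trans ?_)
  · refine Nat.cast_le.2 (Finset.card_le_card fun σ hσ => ?_)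
    rw [Finset.mem_filter] at hσ ⊢
    exact ⟨hσ.1, hthr.trans_lt hσ.2⟩
  · rw [mul_assoc C, mul_assoc C]
    gcongr

end Asymptotics

/-! ### From counting permutations to almost sure bounds -/

section Probability

variable {Ω : Type*} [MeasurableSpace Ω]

lemma measure_perm_le {P : Measure Ω} {d : ℕ} {π : Ω → Equiv.Perm (Fin d)}
    (hπ : ∀ σ, P {ω | π ω = σ} = ((d.factorial : ℕ) : ENNReal)⁻¹)
    (p : Equiv.Perm (Fin d) → Prop) [DecidablePred p] {r : ℝ}
    (h : ((Finset.univ.filter p).card : ℝ) ≤ d.factorial * r) :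
    P {ω | p (π ω)} ≤ ENNReal.ofReal r := by
  have hd : (0 : ℝ) < d.factorial := by positivity
  have h1 : {ω | p (π ω)} ⊆ ⋃ σ ∈ Finset.univ.filter p, {ω | π ω = σ} := by
    intro ω hω
    simpa using hω
  refine (measure_mono h1).trans ((measure_biUnion_finset_le _ _).trans ?_)
  simp only [hπ, Finset.sum_const, nsmul_eq_mul]
  rw [← div_eq_mul_inv]
  refine ENNReal.div_le_of_le_mul ?_
  rw [← ENNReal.ofReal_natCast, ← ENNReal.ofReal_natCast, ← ENNReal.ofReal_mul' hd.le, mul_comm r]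
  exact ENNReal.ofReal_le_ofReal h

theorem ae_lessSim_maxNorm {P : Measure Ω} {M N : ℕ → ℕ} (hN : StrictMono N)
    {A : ∀ n, Matrix (Fin (M n)) (Fin (N n)) ℂ}
    (hA_norm : NormBounded A) (hA_off : OffDiagonalSumCondition A)
    {U : ∀ n, Matrix (Fin (N n)) (Fin (N n)) ℂ}
    (hU : ∀ n, U n ∈ Matrix.unitaryGroup (Fin (N n)) ℂ) (hU_deloc : Delocalized U)
    {π : ∀ n, Ω → Equiv.Perm (Fin (N n))}
    (hπ : ∀ n σ, P {ω | π n ω = σ} = (((N n).factorial : ℕ) : ENNReal)⁻¹)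
    {k : ℕ} (hk : 1 ≤ k) {ε : ℝ} (hε : 0 < ε) :
    ∀ᵐ ω ∂P, LessSim N (fun n => maxNorm
        ((((π n ω).permMatrix ℂ * U n)ᴴ * ((A n)ᴴ * A n) ^ k * ((π n ω).permMatrix ℂ * U n)) -
          ((((A n)ᴴ * A n) ^ k).trace / (N n : ℂ)) • (1 : Matrix (Fin (N n)) (Fin (N n)) ℂ)))
      (fun n => (N n : ℝ) ^ (-1 / 2 + ε : ℝ)) := by
  obtain ⟨C₁, hC₁, C₂, hC₂, N₀, hN₀, H⟩ :=
    exists_card_bad_perm_le hA_norm hA_off hU hU_deloc hk hε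
  set bad : ∀ n, Equiv.Perm (Fin (N n)) → Prop := fun n σ =>
    C₁ * (N n : ℝ) ^ (-1 / 2 + ε : ℝ) <
      maxNorm ((σ.permMatrix ℂ * U n)ᴴ * ((A n)ᴴ * A n) ^ k * (σ.permMatrix ℂ * U n) -
        ((((A n)ᴴ * A n) ^ k).trace / (N n : ℂ)) • (1 : Matrix (Fin (N n)) (Fin (N n)) ℂ))
    with hbad
  have hP : ∀ n, P {ω | N₀ ≤ N n ∧ bad n (π n ω)} ≤
      ENNReal.ofReal (C₂ * ((N n : ℝ) ^ 2)⁻¹) := by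
    intro n
    by_cases hn : N₀ ≤ N n
    · simp only [hn, true_and]
      exact measure_perm_le (hπ n) (bad n) (H n hn)
    · simp [hn]
  -- Injectivity of `N` makes this a subfamily of the convergent series of inverse squares.
  -- Borel–Cantelli then needs no independence between different `n`.
  have hsum : Summable fun n => C₂ * ((N n : ℝ) ^ 2)⁻¹ :=
    ((Real.summable_nat_pow_inv.2 one_lt_two).comp_injective hN.injective).mul_left C₂
  have hne : ∑' n, P {ω | N₀ ≤ N n ∧ bad n (π n ω)} ≠ ⊤ :=
    ne_top_of_le_ne_top hsum.tsum_ofReal_ne_top (ENNReal.tsum_le_tsum hP)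
  filter_upwards [ae_eventually_notMem hne] with ω hω
  obtain ⟨n₀, hn₀⟩ := eventually_atTop.1 hω
  -- `LessSim` has its threshold in the dimension, Borel–Cantelli in the index; strict monotonicity
  -- of `N` translates between them.
  refine ⟨C₁, hC₁, N₀ + N n₀, by omega, fun n hn => ?_⟩
  have h1 : n₀ ≤ n := hN.le_iff_le.1 (by omega)
  have h2 := hn₀ n h1
  simp only [not_and, hbad, not_lt] at h2
  exact h2 (by omega)

lemma LessSim.mono_right {N : ℕ → ℕ} {a b b' : ℕ → ℝ} (h : LessSim N a b)
    (hb : ∀ n, 0 < N n → b n ≤ b' n) : LessSim N a b' := by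
  obtain ⟨C, hC, N₀, hN₀, H⟩ := h
  exact ⟨C, hC, N₀, hN₀, fun n hn =>
    (H n hn).trans (mul_le_mul_of_nonneg_left (hb n (by omega)) hC.le)⟩

end Probability

end RandomMux

/-! ### Membership in the universality class -/

theorem theorem1 {Ω : Type*} [MeasurableSpace Ω] (P : MeasureTheory.Measure Ω)
    [MeasureTheory.IsProbabilityMeasure P]
    (M N : ℕ → ℕ) (hN : StrictMono N)
    (A : ∀ n, Matrix (Fin (M n)) (Fin (N n)) ℂ)
    (hA_spec : RandomMux.SpectrallyConvergent A)
    (hA_norm : RandomMux.NormBounded A)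
    (hA_off : RandomMux.OffDiagonalSumCondition A)
    (U : ∀ n, Matrix (Fin (N n)) (Fin (N n)) ℂ)
    (hU : ∀ n, U n ∈ Matrix.unitaryGroup (Fin (N n)) ℂ)
    (hU_deloc : RandomMux.Delocalized U)
    (Q : ∀ n, Ω → Matrix (Fin (N n)) (Fin (N n)) ℂ)
    (hQ : ∀ n, RandomMux.IsUniformPermMatrix P (Q n))
    (D : ∀ n, Ω → Matrix (Fin (N n)) (Fin (N n)) ℂ)
    (hD : ∀ n, RandomMux.IsUniformPhaseMatrix P (D n))
    (hQD : ∀ n, ProbabilityTheory.IndepFun (Q n) (D n) P) :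
    RandomMux.MemUniversalityClass P (fun n ω => A n * (Q n ω * U n * D n ω)) := by
  choose π hπ_meas hπ_law hπ using hQ
  have hT : ∀ n ω, Q n ω * U n ∈ Matrix.unitaryGroup (Fin (N n)) ℂ := fun n ω => by
    rw [hπ]
    exact RandomMux.permMatrix_mul_mem_unitaryGroup _ (hU n)
  refine ⟨fun n ω => A n * (Q n ω * U n), D, fun n ω => ?_, hD, fun n => ?_, fun n => ?_, ?_⟩
  · simp only [Matrix.mul_assoc]
  -- `J` factors through the finite permutation group, where every map out of the discrete σ-algebra
  -- is measurable.
  · let _ : MeasurableSpace (Equiv.Perm (Fin (N n))) := ⊤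
    have hπn : Measurable (π n) := measurable_to_countable' fun σ => hπ_meas n σ
    have h : (fun ω => A n * (Q n ω * U n)) =
        (fun σ : Equiv.Perm (Fin (N n)) => A n * (σ.permMatrix ℂ * U n)) ∘ π n := by
      funext ω
      simp only [Function.comp_apply, hπ]
    change Measurable fun ω => A n * (Q n ω * U n)
    rw [h]
    exact measurable_from_top.comp hπn
  · have hg : Measurable fun X : Matrix (Fin (N n)) (Fin (N n)) ℂ => A n * (X * U n) := by
      have hent : ∀ i j, Measurable fun X : Matrix (Fin (N n)) (Fin (N n)) ℂ => X i j :=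
        fun i j => (measurable_pi_apply j).comp (measurable_pi_apply i)
      refine measurable_pi_lambda _ fun i => measurable_pi_lambda _ fun j => ?_
      simp only [Matrix.mul_apply]
      exact Finset.measurable_sum _ fun a _ => measurable_const.mul
        (Finset.measurable_sum _ fun b _ => (hent a b).mul measurable_const)
    exact (hQD n).comp hg measurable_id
  -- Restricting `ε` to the values `1 / (m + 1)` leaves countably many null sets; a general `ε`
  -- follows by monotonicity in the exponent.
  · have hconc : ∀ᵐ ω ∂P, ∀ k m : ℕ, 1 ≤ k → RandomMux.LessSim N (fun n => RandomMux.maxNorm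
        ((((π n ω).permMatrix ℂ * U n)ᴴ * ((A n)ᴴ * A n) ^ k * ((π n ω).permMatrix ℂ * U n)) -
          ((((A n)ᴴ * A n) ^ k).trace / (N n : ℂ)) • (1 : Matrix (Fin (N n)) (Fin (N n)) ℂ)))
        (fun n => (N n : ℝ) ^ (-1 / 2 + 1 / ((m : ℝ) + 1) : ℝ)) := by
      refine ae_all_iff.2 fun k => ae_all_iff.2 fun m => ?_
      by_cases hk : 1 ≤ k
      · filter_upwards [RandomMux.ae_lessSim_maxNorm hN hA_norm hA_off hU hU_deloc hπ_law hk
          (ε := 1 / ((m : ℝ) + 1)) (by positivity)] with ω hω _ using hω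
      · exact Eventually.of_forall fun ω h => absurd h hk
    filter_upwards [hconc] with ω hω
    refine ⟨?_, ?_, fun k hk ε hε => ?_⟩
    · obtain ⟨ν, hν, hR, hlim⟩ := hA_spec
      refine ⟨ν, hν, hR, fun k hk => ?_⟩
      simpa only [RandomMux.trace_gram_mul_unitary_pow _ (hT _ ω)] using hlim k hk
    · obtain ⟨C, hC, N₀, hN₀, H⟩ := hA_norm
      refine ⟨C, hC, N₀, hN₀, fun n hn => (RandomMux.specNorm_mul_le _ _).trans ?_⟩
      exact (mul_le_of_le_one_right (RandomMux.specNorm_nonneg _)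
        (RandomMux.specNorm_unitary_le (hT n ω))).trans (H n hn)
    · obtain ⟨m, hm⟩ := exists_nat_one_div_lt hε
      have h := (hω k m hk).mono_right (b' := fun n => (N n : ℝ) ^ (-1 / 2 + ε : ℝ))
        fun n hn => Real.rpow_le_rpow_of_exponent_le (by exact_mod_cast hn) (by linarith)
      simp only [← hπ] at h
      simp only [RandomMux.trace_gram_mul_unitary_pow _ (hT _ ω)]
      simpa only [RandomMux.gram_mul_unitary_pow _ (hT _ ω)] using h
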